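/- \textbf{Conventions.} Let $n\in\mathbb N$, and for $\Phi\in\mathrm{Mat}(n\times n,\mathbb C)$ count eigenvalues without multiplicities. For an eigenvalue $\lambda$ of $\Phi$ and $\ell\ge 1$, let $\vartheta_\ell(\Phi,\lambda)$ be the number of Jordan blocks of size $\ell$ with eigenvalue $\lambda$ in the Jordan normal forms of $\Phi$, let $\vartheta_\ell(\Phi,\bullet)=\sum_\lambda\vartheta_\ell(\Phi,\lambda)$ and $\Theta_\Phi=\prod_\lambda(\lambda I-\Phi)$, where $\lambda$ runs over the (distinct) eigenvalues of $\Phi$. Given a topological space $X$ and a continuous map $A:X\to\mathrm{Mat}(n\times n,\mathbb C)$, a point $\xi\in X$ is a \emph{splitting point of the eigenvalues} of $A$ if every neighborhood of $\xi$ contains a point $\zeta$ such that $A(\zeta)$ has more eigenvalues than $A(\xi)$. Complex spaces are reduced. \textbf{Lemma.} Let $X$ be a topological space, $A:X\to\mathrm{Mat}(n\times n,\mathbb C)$ continuous, and $\xi\in X$ a point that is not a splitting point of the eigenvalues of $A$. Let $w_1,\dots,w_m$ be the (distinct) eigenvalues of $A(\xi)$, with algebraic multiplicities $n_1,\dots,n_m$.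 For an open neighborhood $U$ of $\xi$, call continuous functions $\lambda_1,\dots,\lambda_m:U\to\mathbb C$ \emph{eigenvalue branches} on $U$ if $\lambda_j(\xi)=w_j$ for all $j$ and, for each $\zeta\in U$, the numbers $\lambda_1(\zeta),\dots,\lambda_m(\zeta)$ are pairwise distinct, are precisely the eigenvalues of $A(\zeta)$, and have algebraic multiplicities $n_1,\dots,n_m$, respectively. Then eigenvalue branches exist on every sufficiently small open neighborhood $U$ of $\xi$; they are uniquely determined if $U$ is connected; and they are holomorphic on $U$ if $X$ is a complex space and $A$ is holomorphic. Moreover, for every open neighborhood $U$ of $\xi$ and all eigenvalue branches $\lambda_1,\dots,\lambda_m$ on $U$, the following conditions are equivalent: (i) there is a neighborhood $V\subseteq U$ of $\xi$ such that $\zeta\mapsto\vartheta_\ell(A(\zeta),\lambda_j(\zeta))$ is constant on $V$ for all $1\le j\le m$ and $1\le\ell\le n$; (ii) there is a neighborhood $V\subseteq U$ of $\xi$ such that $\zeta\mapsto\vartheta_\ell(A(\zeta),\bullet)$ is constant on $V$ for all $1\le\ell\le n$; (iii) there is a neighborhood $V\subseteq U$ of $\xi$ such that $\zeta\mapsto\mathrm{rank}\,(\Theta_{A(\zeta)})^k$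 is constant on $V$ for all $1\le k\le n-1$; (iv) there is a neighborhood $V\subseteq U$ of $\xi$ such that $\zeta\mapsto\mathrm{rank}\,(\lambda_j(\zeta)I-A(\zeta))^k$ is constant on $V$ for all $1\le j\le m$ and $1\le k\le n-1$; (v) there are an open neighborhood $V\subseteq U$ of $\xi$ and a continuous map $T:V\to\mathrm{GL}(n,\mathbb C)$ such that $T(\zeta)^{-1}A(\zeta)T(\zeta)$ is in Jordan normal form for all $\zeta\in V$. If $X$ is a complex space and $A$ is holomorphic, the same equivalence also holds with ``continuous map $T$'' in (v) replaced by ``holomorphic map $T$''. -/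

import Mathlib

open Set Filter Topology

noncomputable section

namespace JordanStability

/-! ### Eigenvalues and splitting points -/

/-- The eigenvalues of a complex square matrix, not counting multiplicities. -/
def eigenvalues {n : ℕ} (Φ : Matrix (Fin n) (Fin n) ℂ) : Finset ℂ :=
  (Module.End.finite_hasEigenvalue (Matrix.toLin' Φ)).toFinset

/-- The algebraic multiplicity: the order as a zero of the characteristic polynomial. -/
def algMult {n : ℕ} (Φ : Matrix (Fin n) (Fin n) ℂ) (μ : ℂ) : ℕ :=
  Φ.charpoly.rootMultiplicity μ

/-- `ξ` is a splitting point of the eigenvalues of `A` if every neighborhood of `ξ` contains a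
point `ζ` such that `A ζ` has more eigenvalues than `A ξ` (not counting multiplicities). -/
def IsSplittingPoint {X : Type*} [TopologicalSpace X] {n : ℕ}
    (A : X → Matrix (Fin n) (Fin n) ℂ) (ξ : X) : Prop :=
  ∀ U ∈ 𝓝 ξ, ∃ ζ ∈ U, (eigenvalues (A ξ)).card < (eigenvalues (A ζ)).card

/-- `lam 1, …, lam m` are continuous functions on `U` with `lam j ξ = w j` such that, for each
`ζ ∈ U`, the `lam j ζ` are the (pairwise distinct) eigenvalues of `A ζ`, and the algebraic
multiplicity of `lam j ζ` is that of the eigenvalue `w j` of `A ξ`. -/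
structure IsEigenvalueBranches {X : Type*} [TopologicalSpace X] {n m : ℕ}
    (A : X → Matrix (Fin n) (Fin n) ℂ) (ξ : X) (w : Fin m → ℂ) (U : Set X)
    (lam : Fin m → X → ℂ) : Prop where
  continuousOn : ∀ j, ContinuousOn (lam j) U
  apply_base : ∀ j, lam j ξ = w j
  injective : ∀ ζ ∈ U, Function.Injective fun j => lam j ζ
  mem_iff : ∀ ζ ∈ U, ∀ μ : ℂ, μ ∈ eigenvalues (A ζ) ↔ ∃ j, lam j ζ = μ
  algMult_eq : ∀ ζ ∈ U, ∀ j, algMult (A ζ) (lam j ζ) = algMult (A ξ) (w j)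

/-! ### Jordan normal form -/

/-- The Jordan block `μ I + (δ_{i,j-1})` of size `ℓ`. -/
def jordanBlock (μ : ℂ) (ℓ : ℕ) : Matrix (Fin ℓ) (Fin ℓ) ℂ :=
  Matrix.of fun i j => if i = j then μ else if (i : ℕ) + 1 = (j : ℕ) then 1 else 0

/-- A finite sequence of Jordan blocks (sizes and eigenvalues) of total size `n`. -/
structure JordanData (n : ℕ) where
  r : ℕ
  size : Fin r → ℕ
  eig : Fin r → ℂ
  size_pos : ∀ i, 0 < size i
  sum_size : ∑ i, size i = n

/-- The block diagonal `n × n` matrix with the given Jordan blocks along the diagonal. -/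
def JordanData.toMatrix {n : ℕ} (D : JordanData n) : Matrix (Fin n) (Fin n) ℂ :=
  Matrix.reindex (finSigmaFinEquiv.trans (finCongr D.sum_size))
    (finSigmaFinEquiv.trans (finCongr D.sum_size))
    (Matrix.blockDiagonal' fun i => jordanBlock (D.eig i) (D.size i))

/-- The number of blocks of size `ℓ` and eigenvalue `μ`. -/
def JordanData.count {n : ℕ} (D : JordanData n) (ℓ : ℕ) (μ : ℂ) : ℕ :=
  (Finset.univ.filter fun i => D.size i = ℓ ∧ D.eig i = μ).card

/-- A matrix in Jordan normal form. -/
def IsJordanNormal {n : ℕ} (J : Matrix (Fin n) (Fin n) ℂ) : Prop :=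
  ∃ D : JordanData n, D.toMatrix = J

/-- `D` describes a Jordan normal form of `Φ`. -/
def IsJordanFormOf {n : ℕ} (D : JordanData n) (Φ : Matrix (Fin n) (Fin n) ℂ) : Prop :=
  ∃ P : GL (Fin n) ℂ, ((P⁻¹ : GL (Fin n) ℂ) : Matrix (Fin n) (Fin n) ℂ) * Φ *
    (P : Matrix (Fin n) (Fin n) ℂ) = D.toMatrix

open Classical in
/-- `ϑ_ℓ(Φ, μ)`: the number of Jordan blocks of size `ℓ` of the eigenvalue `μ` in the Jordan
normal forms of `Φ`. (Every complex square matrix has a Jordan normal form, which is unique up to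
the order of the blocks, so neither the choice nor the default value matters.) -/
def vartheta {n : ℕ} (ℓ : ℕ) (Φ : Matrix (Fin n) (Fin n) ℂ) (μ : ℂ) : ℕ :=
  if h : ∃ D : JordanData n, IsJordanFormOf D Φ then h.choose.count ℓ μ else 0

/-- `ϑ_ℓ(Φ, •)`: the sum of `ϑ_ℓ(Φ, μ)` over the eigenvalues `μ` of `Φ`. -/
def varthetaTotal {n : ℕ} (ℓ : ℕ) (Φ : Matrix (Fin n) (Fin n) ℂ) : ℕ :=
  ∑ μ ∈ eigenvalues Φ, vartheta ℓ Φ μ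

/-- The matrix `μ - Φ = μ I - Φ`. -/
def shift {n : ℕ} (Φ : Matrix (Fin n) (Fin n) ℂ) (μ : ℂ) : Matrix (Fin n) (Fin n) ℂ :=
  μ • (1 : Matrix (Fin n) (Fin n) ℂ) - Φ

theorem shift_commute {n : ℕ} (Φ : Matrix (Fin n) (Fin n) ℂ) (μ ν : ℂ) :
    Commute (shift Φ μ) (shift Φ ν) := by
  have h : ∀ c : ℂ, Commute (c • (1 : Matrix (Fin n) (Fin n) ℂ)) Φ := fun c =>
    (Commute.one_left Φ).smul_left c
  exact ((((Commute.one_left _).smul_left μ).sub_right (h μ))).sub_left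
    ((h ν).symm.sub_right (Commute.refl Φ))

/-- `Θ_Φ`: the product of the (pairwise commuting) matrices `μ - Φ` over the eigenvalues `μ` of
`Φ`, each taken once. -/
def bigTheta {n : ℕ} (Φ : Matrix (Fin n) (Fin n) ℂ) : Matrix (Fin n) (Fin n) ℂ :=
  (eigenvalues Φ).noncommProd (shift Φ) fun μ _ ν _ _ => shift_commute Φ μ ν

/-! ### Reduced complex spaces -/

/-- A subset of `ℂ^N` that is locally, near each of its points, the set of common zeros of
finitely many holomorphic functions, i.e. a closed analytic subset of an open set in `ℂ^N`. -/
def IsLocallyAnalytic {N : ℕ} (S : Set (Fin N → ℂ)) : Prop :=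
  ∀ z ∈ S, ∃ W : Set (Fin N → ℂ), IsOpen W ∧ z ∈ W ∧
    ∃ (r : ℕ) (f : Fin r → (Fin N → ℂ) → ℂ), (∀ i, AnalyticOnNhd ℂ (f i) W) ∧
      S ∩ W = {p | p ∈ W ∧ ∀ i, f i p = 0}

/-- A chart: a homeomorphism from an open set `source` onto a locally analytic subset of `ℂ^N`.
Values of `toFun` outside `source` are irrelevant. -/
structure AnalyticChart (X : Type*) [TopologicalSpace X] where
  source : Set X
  isOpen_source : IsOpen source
  N : ℕ
  toFun : X → (Fin N → ℂ)
  isEmbedding : IsEmbedding (source.domRestrict toFun)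
  isLocallyAnalytic : IsLocallyAnalytic (toFun '' source)

/-- The structure of a (reduced) complex space on a topological space: the space is Hausdorff,
and it is covered by charts onto locally analytic sets with holomorphic transition maps, i.e.
transition maps that are locally restrictions of holomorphic maps of the ambient spaces. -/
structure ComplexSpace (X : Type*) [TopologicalSpace X] where
  t2 : T2Space X
  atlas : Set (AnalyticChart X)
  cover : ∀ x : X, ∃ c ∈ atlas, x ∈ c.source
  compatible : ∀ c ∈ atlas, ∀ d ∈ atlas, ∀ x ∈ c.source ∩ d.source,
    ∃ F : (Fin c.N → ℂ) → (Fin d.N → ℂ), AnalyticAt ℂ F (c.toFun x) ∧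
      ∀ᶠ y in 𝓝 x, d.toFun y = F (c.toFun y)

/-- A function is holomorphic on the open set `U` of a complex space if, near each point of `U`,
it is in a chart the restriction of a holomorphic function of the ambient `ℂ^N`. -/
def ComplexSpace.HolomorphicOn {X : Type*} [TopologicalSpace X] (S : ComplexSpace X)
    (f : X → ℂ) (U : Set X) : Prop :=
  ∀ x ∈ U, ∃ c ∈ S.atlas, x ∈ c.source ∧
    ∃ F : (Fin c.N → ℂ) → ℂ, AnalyticAt ℂ F (c.toFun x) ∧ ∀ᶠ y in 𝓝 x, f y = F (c.toFun y)

/-- A matrix-valued function is holomorphic on `U` if all its entries are. -/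
def ComplexSpace.MatrixHolomorphicOn {X : Type*} [TopologicalSpace X] (S : ComplexSpace X)
    {n : ℕ} (A : X → Matrix (Fin n) (Fin n) ℂ) (U : Set X) : Prop :=
  ∀ a b, S.HolomorphicOn (fun ζ => A ζ a b) U

/-! ### The five conditions -/

section Conditions

variable {X : Type*} [TopologicalSpace X]

/-- There is an open neighborhood `V ⊆ U` of `ξ` with the property `P`. -/
def OnNhdWithin (U : Set X) (ξ : X) (P : Set X → Prop) : Prop :=
  ∃ V : Set X, IsOpen V ∧ ξ ∈ V ∧ V ⊆ U ∧ P V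

/-- The map `f` is constant on `V`. -/
def ConstantOn {α : Type*} (f : X → α) (V : Set X) : Prop :=
  ∀ x ∈ V, ∀ y ∈ V, f x = f y

/-- The numbers of Jordan blocks `ϑ_ℓ(A(ζ), λ_j(ζ))` are constant near `ξ`. -/
def BranchBlockCountsConstant {n m : ℕ} (A : X → Matrix (Fin n) (Fin n) ℂ) (ξ : X) (U : Set X)
    (lam : Fin m → X → ℂ) : Prop :=
  OnNhdWithin U ξ fun V => ∀ (j : Fin m) (ℓ : ℕ), 1 ≤ ℓ → ℓ ≤ n →
    ConstantOn (fun ζ => vartheta ℓ (A ζ) (lam j ζ)) V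

/-- The total numbers of Jordan blocks `ϑ_ℓ(A(ζ), •)` are constant near `ξ`. -/
def TotalBlockCountsConstant {n : ℕ} (A : X → Matrix (Fin n) (Fin n) ℂ) (ξ : X)
    (U : Set X) : Prop :=
  OnNhdWithin U ξ fun V => ∀ ℓ : ℕ, 1 ≤ ℓ → ℓ ≤ n →
    ConstantOn (fun ζ => varthetaTotal ℓ (A ζ)) V

/-- The ranks of the powers of `Θ_{A(ζ)}` are constant near `ξ`. -/
def ThetaRanksConstant {n : ℕ} (A : X → Matrix (Fin n) (Fin n) ℂ) (ξ : X) (U : Set X) : Prop :=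
  OnNhdWithin U ξ fun V => ∀ k : ℕ, 1 ≤ k → k ≤ n - 1 →
    ConstantOn (fun ζ => (bigTheta (A ζ) ^ k).rank) V

/-- The ranks of the powers of `λ_j(ζ) - A(ζ)` are constant near `ξ`. -/
def BranchRanksConstant {n m : ℕ} (A : X → Matrix (Fin n) (Fin n) ℂ) (ξ : X) (U : Set X)
    (lam : Fin m → X → ℂ) : Prop :=
  OnNhdWithin U ξ fun V => ∀ (j : Fin m) (k : ℕ), 1 ≤ k → k ≤ n - 1 →
    ConstantOn (fun ζ => (shift (A ζ) (lam j ζ) ^ k).rank) V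

/-- `T(ζ)⁻¹ A(ζ) T(ζ)` is in Jordan normal form for all `ζ ∈ V`. -/
def Jordanizes {n : ℕ} (T : X → GL (Fin n) ℂ) (A : X → Matrix (Fin n) (Fin n) ℂ)
    (V : Set X) : Prop :=
  ∀ ζ ∈ V, IsJordanNormal (((T ζ)⁻¹ : GL (Fin n) ℂ).val * A ζ * (T ζ).val)

/-- Near `ξ`, `A` is brought into Jordan normal form by a continuous map `T` to `GL(n, ℂ)`. -/
def ContinuousJordanization {n : ℕ} (A : X → Matrix (Fin n) (Fin n) ℂ) (ξ : X)
    (U : Set X) : Prop :=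
  OnNhdWithin U ξ fun V => ∃ T : X → GL (Fin n) ℂ, ContinuousOn T V ∧ Jordanizes T A V

/-- Near `ξ`, `A` is brought into Jordan normal form by a holomorphic map `T` to `GL(n, ℂ)`. -/
def HolomorphicJordanization (S : ComplexSpace X) {n : ℕ} (A : X → Matrix (Fin n) (Fin n) ℂ)
    (ξ : X) (U : Set X) : Prop :=
  OnNhdWithin U ξ fun V => ∃ T : X → GL (Fin n) ℂ,
    S.MatrixHolomorphicOn (fun ζ => (T ζ).val) V ∧ Jordanizes T A V

end Conditions

end JordanStability

end

open JordanStability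

namespace JordanStability

/-! Everything is measured by the kernel dimensions of the powers `(λ_j(ζ) - A(ζ)) ^ k`; the pivot
is `BranchNullitiesConstant`. A Jordan block of size `ℓ` contributes `min k ℓ` to the `k`-th kernel
of its own eigenvalue and nothing to the others. So kernel dimensions are linear in the block
counts, and the counts are their second differences (`nullity_eq_sum_vartheta`,
`vartheta_add_nullity_add_nullity`).

For `Θ`, coprimality of the factors makes the kernel dimension of `Θ ^ k` the sum over the
eigenvalues (`nullity_bigTheta_pow`). Each summand is upper semicontinuous along a branch, so a
constant sum forces every summand to be constant (`branchNullitiesConstant_of_thetaRanks`).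

When the kernel dimensions are constant, the generators of the Jordan chains at `ξ` extend to
regular sections of the kernels (`exists_kernel_section`). The chains they generate are the columns
of a matrix that intertwines `A` with a Jordan matrix and stays invertible near `ξ`
(`exists_jordanization`). Conversely, off-diagonal entries of Jordan matrices are 0 or 1, so under a
continuous Jordanization they are locally constant, and the diagonal entries must follow the
branches (`branchNullitiesConstant_of_continuousJordanization`). `RegularityClass` lets one
construction serve both the continuous and the holomorphic case.

Branches exist because eigenvalues persist under perturbation, while the absence of splitting leaves
room for only one near each `w j` (`exists_eigenvalueBranches`). They are holomorphic by the
implicit function theorem, applied to the derivative of the characteristic polynomial in which the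
branch is a simple root. -/

/-! ### Jordan chains from the structure theorem over `ℂ[X]` -/

open Polynomial in
/-- A finite-dimensional complex vector space is spanned by Jordan chains of any endomorphism, with
as many chain vectors as the dimension. -/
theorem exists_spanning_chains {V : Type*} [AddCommGroup V] [Module ℂ V]
    [FiniteDimensional ℂ V] (φ : Module.End ℂ V) :
    ∃ (r : ℕ) (size : Fin r → ℕ) (eig : Fin r → ℂ) (v : Fin r → V),
      (∀ i, 0 < size i) ∧ ∑ i, size i = Module.finrank ℂ V ∧
      (∀ i, ((φ - algebraMap ℂ _ (eig i)) ^ size i) (v i) = 0) ∧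
      ∀ W : Submodule ℂ V,
        (∀ i, ∀ a < size i, ((φ - algebraMap ℂ _ (eig i)) ^ a) (v i) ∈ W) → W = ⊤ := by
  classical
  -- With `X` acting as `φ`, the space is a torsion module over the principal ideal domain `ℂ[X]`,
  -- hence a sum of cyclic primary modules; their generators `u i` start the chains.
  obtain ⟨ι, hι, p, hp, e, ⟨f⟩⟩ :=
    Module.equiv_directSum_of_isTorsion (R := ℂ[X]) (M := Module.AEval' φ)
      (Module.AEval.isTorsion_of_finiteDimensional ℂ V φ)
  have hdeg : ∀ i, (p i).degree = 1 := fun i => IsAlgClosed.degree_eq_one_of_irreducible ℂ (hp i)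
  have hroot : ∀ i, ∃ μ, (p i).IsRoot μ := fun i =>
    IsAlgClosed.exists_root _ (by rw [hdeg i]; exact one_ne_zero)
  choose μ hμ using hroot
  have hassoc : ∀ i, Associated (p i) (X - C (μ i)) := fun i =>
    ((irreducible_X_sub_C (μ i)).associated_of_dvd (hp i)
      (dvd_iff_isRoot.mpr (hμ i))).symm
  let g : ∀ i, ℂ[X] ⧸ Submodule.span ℂ[X] {p i ^ e i} := fun i => Submodule.Quotient.mk 1
  let u : ι → V := fun i =>
    (Module.AEval'.of φ).symm (f.symm (DirectSum.lof ℂ[X] ι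
      (fun i => ℂ[X] ⧸ Submodule.span ℂ[X] {p i ^ e i}) i (g i)))
  have hu : ∀ i (q : ℂ[X]), aeval φ q (u i) =
      (Module.AEval'.of φ).symm (f.symm (DirectSum.lof ℂ[X] ι
      (fun i => ℂ[X] ⧸ Submodule.span ℂ[X] {p i ^ e i}) i (Submodule.Quotient.mk q))) := by
    intro i q
    have h1 : (Submodule.Quotient.mk q : ℂ[X] ⧸ Submodule.span ℂ[X] {p i ^ e i}) = q • g i := by
      simp only [g]
      refine Eq.trans ?_ (Submodule.Quotient.mk_smul (S := ℂ[X]) (Submodule.span ℂ[X] {p i ^ e i}) q 1)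
      rw [smul_eq_mul, mul_one]
    rw [h1, map_smul, map_smul]
    rfl
  have hzero : ∀ i, ((φ - algebraMap ℂ _ (μ i)) ^ e i) (u i) = 0 := by
    intro i
    have h1 : (φ - algebraMap ℂ _ (μ i)) ^ e i = aeval φ ((X - C (μ i)) ^ e i) := by simp
    rw [h1, hu]
    have h2 : (Submodule.Quotient.mk ((X - C (μ i)) ^ e i) :
        ℂ[X] ⧸ Submodule.span ℂ[X] {p i ^ e i}) = 0 := by
      rw [Submodule.Quotient.mk_eq_zero]
      exact Ideal.mem_span_singleton.mpr ((hassoc i).pow_pow.dvd)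
    rw [h2, map_zero, map_zero, map_zero]
  have hspan : ∀ W : Submodule ℂ V,
      (∀ i, ∀ a < e i, ((φ - algebraMap ℂ _ (μ i)) ^ a) (u i) ∈ W) → W = ⊤ := by
    intro W hW
    have h1 : ∀ i (q : ℂ[X]), aeval φ q (u i) ∈ W := by
      intro i q
      -- Expanding `q` in powers of `X - μ i` leaves only chain vectors, since powers from `e i` on
      -- annihilate `u i`.
      rw [← sum_taylor_eq q (μ i), Polynomial.sum, map_sum, LinearMap.sum_apply]
      refine W.sum_mem fun k _ => ?_
      have h2 : (aeval φ (C ((taylor (μ i) q).coeff k) * (X - C (μ i)) ^ k)) (u i) =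
          (taylor (μ i) q).coeff k • ((φ - algebraMap ℂ _ (μ i)) ^ k) (u i) := by
        simp [Module.algebraMap_end_apply]
      rw [h2]
      refine W.smul_mem _ ?_
      by_cases hk : k < e i
      · exact hW i k hk
      · obtain ⟨c, rfl⟩ := Nat.exists_eq_add_of_le (not_lt.mp hk)
        rw [add_comm, pow_add, Module.End.mul_apply, hzero, map_zero]
        exact W.zero_mem
    have h3 : ∀ x, (Module.AEval'.of φ).symm (f.symm x) ∈ W := by
      intro x
      induction x using DirectSum.induction_on with
      | zero => simp
      | of i x =>
        obtain ⟨q, rfl⟩ := Submodule.Quotient.mk_surjective _ x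
        have := h1 i q
        rwa [hu] at this
      | add x y hx hy => rw [map_add, map_add]; exact W.add_mem hx hy
    rw [eq_top_iff]
    intro x _
    have := h3 (f (Module.AEval'.of φ x))
    simpa using this
  have hdim : ∑ i, e i = Module.finrank ℂ V := by
    have h1 : Module.finrank ℂ V =
        Module.finrank ℂ (∀ i, ℂ[X] ⧸ Submodule.span ℂ[X] {p i ^ e i}) :=
      (((Module.AEval'.of φ).trans (f.restrictScalars ℂ)).trans
        ((DirectSum.linearEquivFunOnFintype ℂ[X] ι
          (fun i => ℂ[X] ⧸ Submodule.span ℂ[X] {p i ^ e i})).restrictScalars ℂ)).finrank_eq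
    have hfin : ∀ i, Module.Finite ℂ (ℂ[X] ⧸ Submodule.span ℂ[X] {p i ^ e i}) := fun i =>
      (AdjoinRoot.powerBasis (pow_ne_zero (e i) (hp i).ne_zero)).finite
    rw [h1, Module.finrank_pi_fintype]
    refine Finset.sum_congr rfl fun i _ => ?_
    have h2 := finrank_quotient_span_eq_natDegree (K := ℂ) (f := p i ^ e i)
    have h3 : (p i).natDegree = 1 := natDegree_eq_of_degree_eq_some (hdeg i)
    rw [natDegree_pow, h3, mul_one] at h2
    exact h2.symm
  -- Summands with exponent 0 are trivial modules; they are dropped because block sizes must be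
  -- positive.
  let s := {i : ι // 0 < e i}
  let E : s ≃ Fin (Fintype.card s) := Fintype.equivFin s
  refine ⟨Fintype.card s, fun i => e (E.symm i), fun i => μ (E.symm i), fun i => u (E.symm i),
    fun i => (E.symm i).2, ?_, fun i => hzero _, ?_⟩
  · rw [← hdim, E.symm.sum_comp (fun i : s => e i)]
    exact (Finset.sum_subtype (Finset.univ.filter (0 < e ·)) (by simp) e).symm.trans
      (Finset.sum_filter_of_ne fun i _ h => Nat.pos_of_ne_zero h)
  · intro W hW
    refine hspan W fun i a ha => ?_
    have := hW (E ⟨i, by omega⟩) a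
    simp only [Equiv.symm_apply_apply] at this
    exact this ha

/-! ### Jordan chains as columns of a matrix -/

section Chains

open Matrix

variable {n : ℕ}

/-- The index of the `a`-th coordinate in the `i`-th block. -/
def JordanData.index (D : JordanData n) : (i : Fin D.r) × Fin (D.size i) ≃ Fin n :=
  finSigmaFinEquiv.trans (finCongr D.sum_size)

theorem JordanData.toMatrix_eq (D : JordanData n) :
    D.toMatrix = (Matrix.blockDiagonal' fun i => jordanBlock (D.eig i) (D.size i)).submatrix
      D.index.symm D.index.symm := rfl

/-- The same block sizes with other eigenvalues. -/
def JordanData.withEig (D : JordanData n) (μ : Fin D.r → ℂ) : JordanData n :=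
  { D with eig := μ }

/-- The matrix whose columns are the chains `(Φ - μ_i) ^ (ℓ_i - 1 - a) v_i`, `a < ℓ_i`. -/
def chainMatrix (D : JordanData n) (Φ : Matrix (Fin n) (Fin n) ℂ) (v : Fin D.r → Fin n → ℂ) :
    Matrix (Fin n) (Fin n) ℂ :=
  Matrix.of fun k p => (((-shift Φ (D.eig (D.index.symm p).1)) ^
    (D.size (D.index.symm p).1 - 1 - (D.index.symm p).2)) *ᵥ v (D.index.symm p).1) k

theorem neg_shift_eq (Φ : Matrix (Fin n) (Fin n) ℂ) (μ : ℂ) :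
    -shift Φ μ = Φ - algebraMap ℂ _ μ := by
  rw [shift, neg_sub, Algebra.algebraMap_eq_smul_one]

theorem neg_shift_pow_mulVec_eq_zero_iff (Φ : Matrix (Fin n) (Fin n) ℂ) (μ : ℂ) (k : ℕ)
    (v : Fin n → ℂ) : (-shift Φ μ) ^ k *ᵥ v = 0 ↔ shift Φ μ ^ k *ᵥ v = 0 := by
  rw [neg_pow]
  rcases neg_one_pow_eq_or (Matrix (Fin n) (Fin n) ℂ) k with h | h
  · rw [h, one_mul]
  · rw [h, neg_one_mul, neg_mulVec, neg_eq_zero]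

theorem chainMatrix_apply (D : JordanData n) (Φ : Matrix (Fin n) (Fin n) ℂ)
    (v : Fin D.r → Fin n → ℂ) (k : Fin n) (x : (i : Fin D.r) × Fin (D.size i)) :
    chainMatrix D Φ v k (D.index x) =
      (((-shift Φ (D.eig x.1)) ^ (D.size x.1 - 1 - x.2)) *ᵥ v x.1) k := by
  let g : ((i : Fin D.r) × Fin (D.size i)) → ℂ := fun x =>
    (((-shift Φ (D.eig x.1)) ^ (D.size x.1 - 1 - x.2)) *ᵥ v x.1) k
  change g (D.index.symm (D.index x)) = g x
  rw [Equiv.symm_apply_apply]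

theorem JordanData.toMatrix_apply_index (D : JordanData n)
    (x y : (i : Fin D.r) × Fin (D.size i)) :
    D.toMatrix (D.index x) (D.index y) =
      Matrix.blockDiagonal' (fun i => jordanBlock (D.eig i) (D.size i)) x y := by
  rw [D.toMatrix_eq, submatrix_apply, Equiv.symm_apply_apply, Equiv.symm_apply_apply]

/-- The decreasing exponents `ℓ - 1 - a` make `Φ - μ` send column `a` of a chain to column `a - 1`,
which matches the superdiagonal convention of `jordanBlock`. -/
theorem mul_chainMatrix (D : JordanData n) (Φ : Matrix (Fin n) (Fin n) ℂ)
    (v : Fin D.r → Fin n → ℂ) (hv : ∀ i, shift Φ (D.eig i) ^ D.size i *ᵥ v i = 0) :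
    Φ * chainMatrix D Φ v = chainMatrix D Φ v * D.toMatrix := by
  ext k p
  obtain ⟨⟨i, a⟩, rfl⟩ := D.index.surjective p
  have hR : (chainMatrix D Φ v * D.toMatrix) k (D.index ⟨i, a⟩) =
      ∑ b : Fin (D.size i), (((-shift Φ (D.eig i)) ^ (D.size i - 1 - b)) *ᵥ v i) k *
        jordanBlock (D.eig i) (D.size i) b a := by
    rw [Matrix.mul_apply, ← D.index.sum_comp, Fintype.sum_sigma]
    rw [Finset.sum_eq_single i]
    · refine Finset.sum_congr rfl fun b _ => ?_
      rw [chainMatrix_apply, D.toMatrix_apply_index, blockDiagonal'_apply_eq]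
    · intro j _ hj
      refine Finset.sum_eq_zero fun b _ => ?_
      rw [D.toMatrix_apply_index, blockDiagonal'_apply_ne _ _ _ hj, mul_zero]
    · simp
  have hL : (Φ * chainMatrix D Φ v) k (D.index ⟨i, a⟩) =
      (Φ *ᵥ (((-shift Φ (D.eig i)) ^ (D.size i - 1 - a)) *ᵥ v i)) k := by
    rw [Matrix.mul_apply]
    exact Finset.sum_congr rfl fun l _ => congrArg _ (chainMatrix_apply D Φ v l ⟨i, a⟩)
  have hΦ : Φ = D.eig i • (1 : Matrix (Fin n) (Fin n) ℂ) + -shift Φ (D.eig i) := by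
    rw [shift]; abel
  rw [hR, hL]
  nth_rewrite 1 [hΦ]
  rw [add_mulVec, mulVec_mulVec _ (-shift Φ (D.eig i)), ← pow_succ', smul_mulVec, one_mulVec]
  have hs : ∀ b : Fin (D.size i), (((-shift Φ (D.eig i)) ^ (D.size i - 1 - b)) *ᵥ v i) k *
        jordanBlock (D.eig i) (D.size i) b a =
      (if b = a then D.eig i * (((-shift Φ (D.eig i)) ^ (D.size i - 1 - b)) *ᵥ v i) k else 0) +
      (if (b : ℕ) + 1 = a then (((-shift Φ (D.eig i)) ^ (D.size i - 1 - b)) *ᵥ v i) k else 0) := by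
    intro b
    by_cases h1 : b = a
    · subst h1; simp [jordanBlock, mul_comm]
    · simp [jordanBlock, h1]
  rw [Finset.sum_congr rfl fun b _ => hs b, Finset.sum_add_distrib, Finset.sum_ite_eq' Finset.univ a]
  simp only [Finset.mem_univ, if_true, Pi.add_apply, Pi.smul_apply, smul_eq_mul]
  congr 1
  -- Column 0 already carries the power `ℓ - 1`, so one more application gives 0 by `hv`; any other
  -- column is moved to its left neighbour.
  rcases Nat.eq_zero_or_pos (a : ℕ) with h0 | h0
  · rw [Finset.sum_eq_zero fun b _ => if_neg (by omega)]
    have h1 : D.size i - 1 - (a : ℕ) + 1 = D.size i := by have := D.size_pos i; omega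
    rw [h1, (neg_shift_pow_mulVec_eq_zero_iff _ _ _ _).mpr (hv i), Pi.zero_apply]
  · rw [Finset.sum_eq_single (⟨a - 1, by omega⟩ : Fin (D.size i))]
    · have h1 : D.size i - 1 - (a : ℕ) + 1 = D.size i - 1 - ((a : ℕ) - 1) := by omega
      rw [h1, if_pos (by simp; omega)]
    · intro b _ hb
      refine if_neg fun h => hb ?_
      ext; simp; omega
    · simp

theorem isJordanFormOf_of_mul_eq (D : JordanData n) (Φ : Matrix (Fin n) (Fin n) ℂ)
    (T : GL (Fin n) ℂ) (h : Φ * T.val = T.val * D.toMatrix) :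
    ((T⁻¹ : GL (Fin n) ℂ) : Matrix (Fin n) (Fin n) ℂ) * Φ * T.val = D.toMatrix := by
  rw [mul_assoc, h, ← mul_assoc, Units.inv_mul, one_mul]

/-- The columns of a suitable chain matrix are a Jordan basis. -/
theorem exists_chainMatrix_isUnit (Φ : Matrix (Fin n) (Fin n) ℂ) :
    ∃ (D : JordanData n) (v : Fin D.r → Fin n → ℂ),
      (∀ i, shift Φ (D.eig i) ^ D.size i *ᵥ v i = 0) ∧ IsUnit (chainMatrix D Φ v) := by
  obtain ⟨r, size, eig, v, hpos, hsum, hzero, hspan⟩ :=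
    exists_spanning_chains (Matrix.toLinAlgEquiv' Φ)
  rw [Module.finrank_fintype_fun_eq_card, Fintype.card_fin] at hsum
  have hpow : ∀ i k, ((Matrix.toLinAlgEquiv' Φ - algebraMap ℂ _ (eig i)) ^ k) (v i) =
      (-shift Φ (eig i)) ^ k *ᵥ v i := by
    intro i k
    rw [neg_shift_eq, ← Matrix.toLinAlgEquiv'_apply, map_pow, map_sub, AlgEquiv.commutes]
  let D : JordanData n := ⟨r, size, eig, hpos, hsum⟩
  refine ⟨D, v, fun i => ?_, ?_⟩
  · rw [← neg_shift_pow_mulVec_eq_zero_iff, ← hzero i]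
    exact (hpow i _).symm
  · rw [← Matrix.linearIndependent_cols_iff_isUnit]
    -- There are exactly `n` columns, so spanning suffices; the `a`-th power sits in column `size i
    -- - 1 - a`.
    refine linearIndependent_of_top_le_span_of_card_eq_finrank ?_ (by simp)
    refine (hspan _ fun i a ha => ?_).ge
    rw [hpow]
    have h0 : size i - 1 - a < size i := by omega
    refine Submodule.subset_span ⟨D.index ⟨i, ⟨size i - 1 - a, h0⟩⟩, ?_⟩
    ext k
    have h1 : size i - 1 - (size i - 1 - a) = a := by omega
    refine (chainMatrix_apply D Φ v k _).trans ?_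
    simp only [D, h1]

theorem exists_isJordanFormOf (Φ : Matrix (Fin n) (Fin n) ℂ) : ∃ D, IsJordanFormOf D Φ := by
  obtain ⟨D, v, hv, hu⟩ := exists_chainMatrix_isUnit Φ
  exact ⟨D, hu.unit, isJordanFormOf_of_mul_eq D Φ hu.unit (mul_chainMatrix D Φ v hv)⟩

end Chains

/-! ### Kernel dimensions, block counts and algebraic multiplicities -/

section KernelDimension

open Matrix

/-- The dimension of the kernel of a matrix. -/
noncomputable def nullity {ι : Type*} [Fintype ι] (M : Matrix ι ι ℂ) : ℕ :=
  Module.finrank ℂ (LinearMap.ker M.mulVecLin)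

theorem rank_add_nullity {ι : Type*} [Fintype ι] (M : Matrix ι ι ℂ) :
    M.rank + nullity M = Fintype.card ι := by
  rw [Matrix.rank, nullity, LinearMap.finrank_range_add_finrank_ker,
    Module.finrank_fintype_fun_eq_card]

theorem nullity_eq_zero_of_isUnit_det {ι : Type*} [Fintype ι] [DecidableEq ι] (M : Matrix ι ι ℂ)
    (h : IsUnit M.det) : nullity M = 0 := by
  have h1 := rank_add_nullity M
  rw [Matrix.rank_of_isUnit M ((Matrix.isUnit_iff_isUnit_det M).mpr h)] at h1
  omega

theorem nullity_blockDiagonal' {o : Type*} [Fintype o] [DecidableEq o] {m : o → Type*}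
    [∀ i, Fintype (m i)] (M : ∀ i, Matrix (m i) (m i) ℂ) :
    nullity (Matrix.blockDiagonal' M) = ∑ i, nullity (M i) := by
  have hmul : ∀ (x : (Σ i, m i) → ℂ) (i : o) (a : m i),
      (Matrix.blockDiagonal' M *ᵥ x) ⟨i, a⟩ = (M i *ᵥ fun b => x ⟨i, b⟩) a := by
    intro x i a
    rw [mulVec, dotProduct, Fintype.sum_sigma, Finset.sum_eq_single i]
    · simp [mulVec, dotProduct]
    · intro j _ hj
      exact Finset.sum_eq_zero fun b _ => by rw [blockDiagonal'_apply_ne _ _ _ hj.symm, zero_mul]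
    · simp
  let e : LinearMap.ker (Matrix.blockDiagonal' M).mulVecLin ≃ₗ[ℂ]
      ∀ i, LinearMap.ker (M i).mulVecLin :=
    { toFun := fun x i => ⟨fun a => x.1 ⟨i, a⟩, by
        ext a
        have := congrFun x.2 ⟨i, a⟩
        rw [mulVecLin_apply, hmul] at this
        exact this⟩
      map_add' := fun x y => rfl
      map_smul' := fun c x => rfl
      invFun := fun y => ⟨fun p => (y p.1).1 p.2, by
        ext ⟨i, a⟩
        rw [mulVecLin_apply, hmul]
        exact congrFun (y i).2 a⟩
      left_inv := fun x => rfl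
      right_inv := fun y => rfl }
  rw [nullity, e.finrank_eq, Module.finrank_pi_fintype]
  rfl

theorem nullity_submatrix_equiv {ι κ : Type*} [Fintype ι] [Fintype κ] (M : Matrix ι ι ℂ)
    (e : κ ≃ ι) : nullity (M.submatrix e e) = nullity M := by
  have h1 := rank_add_nullity M
  have h2 := rank_add_nullity (M.submatrix e e)
  rw [Matrix.rank_submatrix] at h2
  have := Fintype.card_congr e
  omega

theorem nullity_conj {n : ℕ} (P : GL (Fin n) ℂ) (M : Matrix (Fin n) (Fin n) ℂ) :
    nullity ((P⁻¹ : GL (Fin n) ℂ).val * M * P.val) = nullity M := by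
  have h1 := rank_add_nullity M
  have h2 := rank_add_nullity ((P⁻¹ : GL (Fin n) ℂ).val * M * P.val)
  rw [Matrix.rank_mul_eq_left_of_isUnit_det _ _ ((Matrix.isUnit_iff_isUnit_det _).mp P.isUnit),
    Matrix.rank_mul_eq_right_of_isUnit_det _ _
      ((Matrix.isUnit_iff_isUnit_det _).mp (P⁻¹).isUnit)] at h2
  omega

/-- On its own block, `shift` is minus the nilpotent superdiagonal matrix, whence the translation of
coordinates and the sign. -/
theorem shift_jordanBlock_pow_mulVec (μ : ℂ) (ℓ k : ℕ) (v : Fin ℓ → ℂ) (a : Fin ℓ) :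
    (shift (jordanBlock μ ℓ) μ ^ k *ᵥ v) a =
      (-1) ^ k * if h : (a : ℕ) + k < ℓ then v ⟨a + k, h⟩ else 0 := by
  have h1 : ∀ (v : Fin ℓ → ℂ) (a : Fin ℓ), (shift (jordanBlock μ ℓ) μ *ᵥ v) a =
      - if h : (a : ℕ) + 1 < ℓ then v ⟨a + 1, h⟩ else 0 := by
    intro v a
    have hs : ∀ b, shift (jordanBlock μ ℓ) μ a b * v b =
        if (a : ℕ) + 1 = b then - v b else 0 := by
      intro b
      by_cases hab : a = b
      · subst hab; simp [shift, jordanBlock]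
      · by_cases h2 : (a : ℕ) + 1 = b <;> simp [shift, jordanBlock, hab, h2]
    rw [mulVec, dotProduct, Finset.sum_congr rfl fun b _ => hs b]
    split_ifs with h
    · rw [Finset.sum_eq_single (⟨a + 1, h⟩ : Fin ℓ)]
      · simp
      · intro b _ hb
        exact if_neg fun h' => hb (by ext; simp; omega)
      · simp
    · rw [neg_zero]
      exact Finset.sum_eq_zero fun b _ => if_neg (by omega)
  induction k generalizing a with
  | zero => simp
  | succ k ih =>
    rw [pow_succ', ← mulVec_mulVec, h1]
    by_cases h : (a : ℕ) + 1 < ℓ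
    · rw [dif_pos h, ih]
      have h3 : (a : ℕ) + 1 + k = a + (k + 1) := by omega
      simp only [h3]
      rw [pow_succ]; ring
    · rw [dif_neg h, dif_neg (by omega)]; simp

theorem nullity_shift_jordanBlock_self (μ : ℂ) (ℓ k : ℕ) :
    nullity (shift (jordanBlock μ ℓ) μ ^ k) = min k ℓ := by
  -- The kernel is the coordinate subspace where all coordinates of index at least `k` vanish.
  have hk : LinearMap.ker (shift (jordanBlock μ ℓ) μ ^ k).mulVecLin =
      ⨅ i ∈ {i : Fin ℓ | ¬ (i : ℕ) < k},
        LinearMap.ker (LinearMap.proj (R := ℂ) (φ := fun _ : Fin ℓ => ℂ) i) := by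
    ext v
    simp only [LinearMap.mem_ker, mulVecLin_apply, Submodule.mem_iInf, mem_ofPred_eq,
      LinearMap.proj_apply]
    constructor
    · intro h i hi
      have h2 := congrFun h ⟨i - k, by omega⟩
      rw [shift_jordanBlock_pow_mulVec, dif_pos (by simp; omega)] at h2
      have h3 : (i : ℕ) - k + k = i := by omega
      simpa [h3] using h2
    · intro h
      ext a
      rw [shift_jordanBlock_pow_mulVec]
      split_ifs with h2
      · rw [h _ (by simp)]; simp
      · simp
  rw [nullity, hk, (LinearMap.iInfKerProjEquiv ℂ (fun _ : Fin ℓ => ℂ)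
    (I := {i : Fin ℓ | (i : ℕ) < k}) (J := {i : Fin ℓ | ¬ (i : ℕ) < k})
    (by rw [Set.disjoint_left]; intro i hi hi'; exact hi' hi)
    (by intro i _; exact Classical.em _)).finrank_eq]
  rw [Module.finrank_fintype_fun_eq_card]
  refine (Fintype.card_subtype (fun i : Fin ℓ => (i : ℕ) < k)).trans ?_
  rw [Fin.card_filter_val_lt, min_comm]

theorem nullity_shift_jordanBlock_of_ne {μ ν : ℂ} (h : ν ≠ μ) (ℓ k : ℕ) :
    nullity (shift (jordanBlock ν ℓ) μ ^ k) = 0 := by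
  apply nullity_eq_zero_of_isUnit_det
  rw [det_pow]
  refine IsUnit.pow _ ?_
  rw [Matrix.det_of_isUpperTriangular]
  · have : ∀ i, shift (jordanBlock ν ℓ) μ i i = μ - ν := by
      intro i; simp [shift, jordanBlock]
    rw [Finset.prod_congr rfl fun i _ => this i, Finset.prod_const]
    exact (isUnit_iff_ne_zero.mpr (sub_ne_zero.mpr h.symm)).pow _
  · intro i j hij
    have hij' : (j : ℕ) < i := hij
    have h1 : i ≠ j := fun h => by subst h; omega
    have h2 : ¬ (i : ℕ) + 1 = j := by omega
    simp [shift, jordanBlock, h1, h2]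

variable {n : ℕ}

/-- Conjugation reduces this to a block diagonal matrix: blocks for `μ` become nilpotent after the
shift, and the others remain invertible. -/
theorem nullity_shift_pow_of_isJordanFormOf {D : JordanData n} {Φ : Matrix (Fin n) (Fin n) ℂ}
    (h : IsJordanFormOf D Φ) (μ : ℂ) (k : ℕ) :
    nullity (shift Φ μ ^ k) = ∑ i with D.eig i = μ, min k (D.size i) := by
  obtain ⟨P, hP⟩ := h
  have h1 : (P⁻¹ : GL (Fin n) ℂ).val * shift Φ μ ^ k * P.val = shift D.toMatrix μ ^ k := by
    have hc : (P⁻¹ : GL (Fin n) ℂ).val * shift Φ μ * P.val = shift D.toMatrix μ := by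
      rw [shift, mul_sub, sub_mul, hP, shift]
      simp
    rw [← hc]
    exact (Units.conj_pow' P _ k).symm
  have h2 : shift D.toMatrix μ ^ k = (Matrix.blockDiagonal' fun i =>
      shift (jordanBlock (D.eig i) (D.size i)) μ ^ k).submatrix D.index.symm D.index.symm := by
    have h3 : shift D.toMatrix μ = (Matrix.blockDiagonal' fun i =>
        shift (jordanBlock (D.eig i) (D.size i)) μ).submatrix D.index.symm D.index.symm := by
      have h4 : (Matrix.blockDiagonal' fun i => shift (jordanBlock (D.eig i) (D.size i)) μ) =
          μ • 1 - Matrix.blockDiagonal' fun i => jordanBlock (D.eig i) (D.size i) := by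
        rw [← blockDiagonal'_one, ← blockDiagonal'_smul, ← blockDiagonal'_sub]
        rfl
      rw [h4, shift, D.toMatrix_eq]
      ext p q
      simp [Matrix.one_apply]
    rw [h3]
    have h5 := map_pow (Matrix.reindexAlgEquiv ℂ ℂ D.index) (Matrix.blockDiagonal' fun i =>
        shift (jordanBlock (D.eig i) (D.size i)) μ) k
    rw [← blockDiagonal'_pow] at h5
    exact h5.symm
  rw [← nullity_conj P, h1, h2, nullity_submatrix_equiv, nullity_blockDiagonal', Finset.sum_filter]
  refine Finset.sum_congr rfl fun i _ => ?_
  split_ifs with h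
  · rw [h, nullity_shift_jordanBlock_self]
  · exact nullity_shift_jordanBlock_of_ne h _ _

theorem vartheta_eq_count (Φ : Matrix (Fin n) (Fin n) ℂ) :
    ∃ D, IsJordanFormOf D Φ ∧ ∀ ℓ μ, vartheta ℓ Φ μ = D.count ℓ μ :=
  ⟨(exists_isJordanFormOf Φ).choose, (exists_isJordanFormOf Φ).choose_spec, fun ℓ μ => by
    rw [vartheta, dif_pos (exists_isJordanFormOf Φ)]⟩

/-- The block counts are second differences of the kernel dimensions. -/
theorem vartheta_add_nullity_add_nullity (Φ : Matrix (Fin n) (Fin n) ℂ) (μ : ℂ) (ℓ : ℕ) :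
    vartheta (ℓ + 1) Φ μ + nullity (shift Φ μ ^ ℓ) + nullity (shift Φ μ ^ (ℓ + 2)) =
      2 * nullity (shift Φ μ ^ (ℓ + 1)) := by
  obtain ⟨D, hD, hc⟩ := vartheta_eq_count Φ
  have h1 : D.count (ℓ + 1) μ = ∑ i with D.eig i = μ, if D.size i = ℓ + 1 then 1 else 0 := by
    rw [JordanData.count, Finset.card_filter, Finset.sum_filter]
    refine Finset.sum_congr rfl fun i _ => ?_
    by_cases h2 : D.eig i = μ <;> simp [h2]
  rw [hc, h1]
  simp only [nullity_shift_pow_of_isJordanFormOf hD]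
  rw [← Finset.sum_add_distrib, ← Finset.sum_add_distrib, Finset.mul_sum]
  refine Finset.sum_congr rfl fun i _ => ?_
  -- Blockwise, `2 min(ℓ+1, s) - min(ℓ, s) - min(ℓ+2, s)` is 1 if `s = ℓ + 1` and 0 otherwise.
  split_ifs <;> omega

theorem JordanData.size_le (D : JordanData n) (i : Fin D.r) : D.size i ≤ n := by
  conv_rhs => rw [← D.sum_size]
  exact Finset.single_le_sum (f := D.size) (fun _ _ => Nat.zero_le _) (Finset.mem_univ i)

theorem nullity_eq_sum_vartheta (Φ : Matrix (Fin n) (Fin n) ℂ) (μ : ℂ) (k : ℕ) :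
    nullity (shift Φ μ ^ k) = ∑ ℓ ∈ Finset.Icc 1 n, min k ℓ * vartheta ℓ Φ μ := by
  obtain ⟨D, hD, hc⟩ := vartheta_eq_count Φ
  rw [nullity_shift_pow_of_isJordanFormOf hD,
    ← Finset.sum_fiberwise_of_maps_to (g := D.size) (t := Finset.Icc 1 n)
      fun i _ => Finset.mem_Icc.mpr ⟨D.size_pos i, D.size_le i⟩]
  refine Finset.sum_congr rfl fun ℓ _ => ?_
  rw [hc, JordanData.count, Finset.filter_filter,
    Finset.sum_congr rfl (g := fun _ => min k ℓ) (by
      intro i hi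
      rw [(Finset.mem_filter.mp hi).2.2]), Finset.sum_const, smul_eq_mul, mul_comm]
  simp only [and_comm]

theorem mulVecLin_shift_pow (Φ : Matrix (Fin n) (Fin n) ℂ) (μ : ℂ) (k : ℕ) :
    LinearMap.ker (shift Φ μ ^ k).mulVecLin = (Module.End.genEigenspace (Matrix.toLin' Φ) μ) k := by
  ext v
  rw [LinearMap.mem_ker, mulVecLin_apply, ← neg_shift_pow_mulVec_eq_zero_iff,
    Module.End.mem_genEigenspace_nat, LinearMap.mem_ker]
  have : (-shift Φ μ) ^ k *ᵥ v = ((Matrix.toLin' Φ - μ • 1) ^ k) v := by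
    rw [neg_shift_eq, ← Matrix.toLinAlgEquiv'_apply, map_pow, map_sub, AlgEquiv.commutes]
    rfl
  rw [this]

/-- By exponent `n` the kernels have stabilised at the maximal generalized eigenspace, whose
dimension is the multiplicity of the root. -/
theorem nullity_shift_pow_of_le (Φ : Matrix (Fin n) (Fin n) ℂ) (μ : ℂ) {k : ℕ} (hk : n ≤ k) :
    nullity (shift Φ μ ^ k) = algMult Φ μ := by
  rw [nullity, mulVecLin_shift_pow, algMult, ← Matrix.charpoly_toLin',
    ← LinearMap.finrank_maxGenEigenspace_eq]
  have h1 := Module.End.maxGenEigenspace_eq_genEigenspace_finrank (Matrix.toLin' Φ) μ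
  rw [Module.finrank_fintype_fun_eq_card, Fintype.card_fin] at h1
  refine congrArg (fun W : Submodule ℂ (Fin n → ℂ) => Module.finrank ℂ W) (le_antisymm ?_ ?_)
  · exact Module.End.genEigenspace_le_maximal _ _ _
  · rw [h1]
    exact (Module.End.genEigenspace _ _).mono (by exact_mod_cast hk)

theorem mem_eigenvalues_iff_isRoot (Φ : Matrix (Fin n) (Fin n) ℂ) (μ : ℂ) :
    μ ∈ eigenvalues Φ ↔ Φ.charpoly.IsRoot μ := by
  rw [eigenvalues, Set.Finite.mem_toFinset, Set.mem_ofPred_eq,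
    Module.End.hasEigenvalue_iff_isRoot_charpoly, Matrix.charpoly_toLin']

theorem mem_eigenvalues_of_isJordanFormOf {D : JordanData n} {Φ : Matrix (Fin n) (Fin n) ℂ}
    (h : IsJordanFormOf D Φ) (i : Fin D.r) : D.eig i ∈ eigenvalues Φ := by
  rw [mem_eigenvalues_iff_isRoot, ← Polynomial.rootMultiplicity_pos (Φ.charpoly_monic.ne_zero)]
  have h1 := nullity_shift_pow_of_isJordanFormOf h (D.eig i) n
  rw [nullity_shift_pow_of_le _ _ le_rfl, algMult] at h1
  rw [h1]
  have h2 : min n (D.size i) ≤ ∑ j with D.eig j = D.eig i, min n (D.size j) :=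
    Finset.single_le_sum (f := fun j => min n (D.size j)) (fun _ _ => Nat.zero_le _) (by simp)
  have h3 := D.size_pos i
  have h4 := D.size_le i
  omega

-- Factors for distinct `μ` are coprime polynomials, so the kernel of the product is the direct sum
-- of the kernels.
open Polynomial in
theorem nullity_aeval_prod (Φ : Matrix (Fin n) (Fin n) ℂ) (k : ℕ) (s : Finset ℂ) :
    nullity (aeval Φ (∏ μ ∈ s, (C μ - X) ^ k)) = ∑ μ ∈ s, nullity (shift Φ μ ^ k) := by
  classical
  have hker : ∀ p : ℂ[X], LinearMap.ker (aeval Φ p).mulVecLin =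
      LinearMap.ker (aeval (Matrix.toLinAlgEquiv' Φ) p) := by
    intro p
    have h1 := aeval_algHom_apply (Matrix.toLinAlgEquiv' (R := ℂ) (n := Fin n)) Φ p
    rw [h1]
    rfl
  induction s using Finset.induction_on with
  | empty => simp [nullity_eq_zero_of_isUnit_det]
  | insert μ s hμ ih =>
    have hcop : IsCoprime ((C μ - X) ^ k) (∏ ν ∈ s, (C ν - X) ^ k) := by
      refine IsCoprime.prod_right fun ν hν => IsCoprime.pow ?_
      have h1 : μ ≠ ν := fun h => hμ (h ▸ hν)
      have h2 := (isCoprime_X_sub_C_of_isUnit_sub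
        (isUnit_iff_ne_zero.mpr (sub_ne_zero.mpr h1))).neg_neg
      rwa [neg_sub, neg_sub] at h2
    rw [Finset.prod_insert hμ, Finset.sum_insert hμ, ← ih]
    have h1 := sup_ker_aeval_eq_ker_aeval_mul_of_coprime (Matrix.toLinAlgEquiv' Φ) hcop
    have h2 := disjoint_ker_aeval_of_isCoprime (Matrix.toLinAlgEquiv' Φ) hcop
    have h3 := Submodule.finrank_sup_add_finrank_inf_eq
      (LinearMap.ker (aeval (Matrix.toLinAlgEquiv' Φ) ((C μ - X) ^ k)))
      (LinearMap.ker (aeval (Matrix.toLinAlgEquiv' Φ) (∏ ν ∈ s, (C ν - X) ^ k)))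
    rw [h2.eq_bot, finrank_bot, add_zero, h1, ← hker, ← hker, ← hker] at h3
    have h4 : aeval Φ ((C μ - X) ^ k) = shift Φ μ ^ k := by
      simp [shift, Algebra.algebraMap_eq_smul_one]
    rw [h4] at h3
    exact h3

open Polynomial in
theorem nullity_bigTheta_pow (Φ : Matrix (Fin n) (Fin n) ℂ) (k : ℕ) :
    nullity (bigTheta Φ ^ k) = ∑ μ ∈ eigenvalues Φ, nullity (shift Φ μ ^ k) := by
  rw [← nullity_aeval_prod, Finset.prod_pow, map_pow]
  congr 2
  have h1 := Finset.map_noncommProd (eigenvalues Φ) (fun μ : ℂ => C μ - X)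
    (fun _ _ _ _ _ => Commute.all _ _) (aeval Φ)
  rw [Finset.noncommProd_eq_prod] at h1
  rw [h1]
  refine Finset.noncommProd_congr rfl (fun μ _ => ?_) _
  simp [shift, Algebra.algebraMap_eq_smul_one]

end KernelDimension

/-! ### Perturbation of kernels -/

section Perturbation

open Matrix

variable {n : ℕ}

/-- Let `B` map the kernel of `M` isomorphically onto a complement of the range, and vanish on a
complement of the kernel. -/
theorem exists_isUnit_add (M : Matrix (Fin n) (Fin n) ℂ) :
    ∃ B : Matrix (Fin n) (Fin n) ℂ, IsUnit (M + B) ∧ B.rank ≤ nullity M := by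
  obtain ⟨C, hC⟩ := Submodule.exists_isCompl (LinearMap.ker M.mulVecLin)
  obtain ⟨D, hD⟩ := Submodule.exists_isCompl (LinearMap.range M.mulVecLin)
  have hdim : Module.finrank ℂ (LinearMap.ker M.mulVecLin) = Module.finrank ℂ D := by
    have h1 := Submodule.finrank_add_eq_of_isCompl hD
    have h2 := LinearMap.finrank_range_add_finrank_ker M.mulVecLin
    omega
  let e := LinearEquiv.ofFinrankEq _ _ hdim
  let b : (Fin n → ℂ) →ₗ[ℂ] (Fin n → ℂ) :=
    D.subtype ∘ₗ e.toLinearMap ∘ₗ Submodule.projectionOnto _ C hC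
  refine ⟨LinearMap.toMatrix' b, ?_, ?_⟩
  · rw [← Matrix.mulVec_injective_iff_isUnit, ← Matrix.coe_mulVecLin]
    refine (injective_iff_map_eq_zero _).mpr fun v hv => ?_
    rw [mulVecLin_apply, add_mulVec, LinearMap.toMatrix'_mulVec] at hv
    have h1 : M *ᵥ v ∈ LinearMap.range M.mulVecLin := ⟨v, rfl⟩
    have h2 : b v ∈ D := (e _).2
    have h3 : b v = 0 := by
      refine Submodule.disjoint_def.mp hD.disjoint _ ?_ h2
      rw [eq_neg_of_add_eq_zero_right hv]
      exact Submodule.neg_mem _ h1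
    have h4 : M *ᵥ v = 0 := by rw [h3, add_zero] at hv; exact hv
    have h5 : Submodule.projectionOnto _ C hC v = 0 := by
      have h6 : e (Submodule.projectionOnto _ C hC v) = 0 := Subtype.ext h3
      exact e.map_eq_zero_iff.mp h6
    rw [Submodule.projectionOnto_apply_eq_zero_iff] at h5
    exact Submodule.disjoint_def.mp hC.disjoint v h4 h5
  · rw [Matrix.rank, nullity, hdim]
    refine Submodule.finrank_mono ?_
    rintro _ ⟨v, rfl⟩
    rw [mulVecLin_apply, LinearMap.toMatrix'_mulVec]
    exact (e _).2

theorem disjoint_ker_of_isUnit_add {M B : Matrix (Fin n) (Fin n) ℂ} (h : IsUnit (M + B)) :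
    Disjoint (LinearMap.ker M.mulVecLin) (LinearMap.ker B.mulVecLin) := by
  rw [Submodule.disjoint_def]
  intro v hM hB
  rw [LinearMap.mem_ker, mulVecLin_apply] at hM hB
  refine Matrix.mulVec_injective_iff_isUnit.mpr h ?_
  rw [add_mulVec, hM, hB, add_zero, mulVec_zero]

/-- The kernels of `M` and `B` meet trivially. As invertibility of `M + B` is an open condition in
`M`, this bound yields semicontinuity of the nullity. -/
theorem nullity_le_rank_of_isUnit_add {M B : Matrix (Fin n) (Fin n) ℂ} (h : IsUnit (M + B)) :
    nullity M ≤ B.rank := by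
  have h1 := rank_add_nullity B
  have h2 := Submodule.finrank_add_finrank_le_of_disjoint (disjoint_ker_of_isUnit_add h)
  rw [Module.finrank_fintype_fun_eq_card] at h2
  unfold nullity at *
  omega

/-- If `M + B` is invertible and `B` has the rank of a complement of `M`, then
`v - (M + B)⁻¹ M v` is in the kernel of `M`. -/
theorem mulVec_sub_inv_mulVec_eq_zero {M B : Matrix (Fin n) (Fin n) ℂ} (h : IsUnit (M + B))
    (hB : B.rank ≤ nullity M) (v : Fin n → ℂ) :
    M *ᵥ (v - (M + B)⁻¹ *ᵥ (M *ᵥ v)) = 0 := by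
  have hd := disjoint_ker_of_isUnit_add h
  have hsup : LinearMap.ker M.mulVecLin ⊔ LinearMap.ker B.mulVecLin = ⊤ := by
    refine Submodule.eq_top_of_disjoint _ _ ?_ hd
    have h1 := rank_add_nullity B
    rw [Module.finrank_fintype_fun_eq_card]
    unfold nullity at *
    omega
  -- Since `M v = M c = (M + B) c`, the subtracted term is `c`: the expression is the projection
  -- onto the kernel of `M` along that of `B`.
  obtain ⟨a, ha, c, hc, rfl⟩ := Submodule.mem_sup.mp (hsup.ge (Submodule.mem_top (x := v)))
  rw [LinearMap.mem_ker, mulVecLin_apply] at ha hc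
  have h1 : M *ᵥ (a + c) = (M + B) *ᵥ c := by
    rw [mulVec_add, ha, add_mulVec, hc, zero_add, add_zero]
  rw [h1, mulVec_mulVec, Matrix.nonsing_inv_mul _ ((Matrix.isUnit_iff_isUnit_det _).mp h),
    one_mulVec, add_sub_cancel_right, ha]

end Perturbation

/-! ### Classes of regular functions -/

/-- For each point `x`, an algebra of functions that are regular at `x`; regularity is local,
implies continuity, and is preserved by inversion. -/
structure RegularityClass (X : Type*) [TopologicalSpace X] where
  at_ : X → Subalgebra ℂ (X → ℂ)
  congr : ∀ {x : X} {f g : X → ℂ}, f ∈ at_ x → f =ᶠ[𝓝 x] g → g ∈ at_ x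
  inv : ∀ {x : X} {f : X → ℂ}, f ∈ at_ x → f x ≠ 0 → f⁻¹ ∈ at_ x
  continuousAt : ∀ {x : X} {f : X → ℂ}, f ∈ at_ x → ContinuousAt f x

namespace RegularityClass

variable {X : Type*} [TopologicalSpace X]

/-- Continuity as a regularity class. -/
def continuous (X : Type*) [TopologicalSpace X] : RegularityClass X where
  at_ x :=
    { carrier := {f | ContinuousAt f x}
      mul_mem' := fun hf hg => ContinuousAt.mul hf hg
      add_mem' := fun hf hg => ContinuousAt.add hf hg
      algebraMap_mem' := fun _ => continuousAt_const }
  congr := fun hf h => ContinuousAt.congr hf h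
  inv := fun hf h => ContinuousAt.inv₀ hf h
  continuousAt := fun hf => hf

variable (R : RegularityClass X) {n : ℕ} {x : X}

/-- A matrix-valued function is regular at `x` if its entries are. -/
def MatrixAt {ι κ : Type*} (A : X → Matrix ι κ ℂ) (x : X) : Prop :=
  ∀ a b, (fun ζ => A ζ a b) ∈ R.at_ x

theorem const_mem (c : ℂ) (x : X) : (fun _ => c) ∈ R.at_ x := (R.at_ x).algebraMap_mem c

/-- Evaluation at a point, as a ring homomorphism. -/
def evalAt (x ζ : X) : R.at_ x →+* ℂ :=
  (Pi.evalRingHom (fun _ : X => ℂ) ζ).comp (R.at_ x).val.toRingHom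

variable {R}

/-- Regarded as one matrix over the ring `R.at_ x`, with evaluations as ring homomorphisms, `A` has
its products, determinant, adjugate and characteristic polynomial computed in that ring, hence
regular. -/
theorem MatrixAt.exists_lift {A : X → Matrix (Fin n) (Fin n) ℂ} (hA : R.MatrixAt A x) :
    ∃ L : Matrix (Fin n) (Fin n) (R.at_ x), ∀ ζ, (R.evalAt x ζ).mapMatrix L = A ζ :=
  ⟨Matrix.of fun a b => ⟨fun ζ => A ζ a b, hA a b⟩, fun _ => rfl⟩

theorem matrixAt_of_lift {A : X → Matrix (Fin n) (Fin n) ℂ}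
    (L : Matrix (Fin n) (Fin n) (R.at_ x)) (h : ∀ ζ, (R.evalAt x ζ).mapMatrix L = A ζ) :
    R.MatrixAt A x := by
  intro a b
  have : (fun ζ => A ζ a b) = (L a b).1 := by
    funext ζ
    rw [← h ζ]
    rfl
  rw [this]
  exact (L a b).2

theorem MatrixAt.const (M : Matrix (Fin n) (Fin n) ℂ) : R.MatrixAt (fun _ => M) x :=
  fun a b => R.const_mem (M a b) x

theorem MatrixAt.mul {A B : X → Matrix (Fin n) (Fin n) ℂ} (hA : R.MatrixAt A x)
    (hB : R.MatrixAt B x) : R.MatrixAt (fun ζ => A ζ * B ζ) x := by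
  obtain ⟨L, hL⟩ := hA.exists_lift
  obtain ⟨K, hK⟩ := hB.exists_lift
  exact matrixAt_of_lift (L * K) fun ζ => by rw [map_mul, hL, hK]

theorem MatrixAt.pow {A : X → Matrix (Fin n) (Fin n) ℂ} (hA : R.MatrixAt A x) (k : ℕ) :
    R.MatrixAt (fun ζ => A ζ ^ k) x := by
  obtain ⟨L, hL⟩ := hA.exists_lift
  exact matrixAt_of_lift (L ^ k) fun ζ => by rw [map_pow, hL]

theorem MatrixAt.add {A B : X → Matrix (Fin n) (Fin n) ℂ} (hA : R.MatrixAt A x)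
    (hB : R.MatrixAt B x) : R.MatrixAt (fun ζ => A ζ + B ζ) x :=
  fun a b => (R.at_ x).add_mem (hA a b) (hB a b)

theorem MatrixAt.neg {A : X → Matrix (Fin n) (Fin n) ℂ} (hA : R.MatrixAt A x) :
    R.MatrixAt (fun ζ => -A ζ) x :=
  fun a b => (R.at_ x).neg_mem (hA a b)

theorem MatrixAt.shift {A : X → Matrix (Fin n) (Fin n) ℂ} (hA : R.MatrixAt A x) {μ : X → ℂ}
    (hμ : μ ∈ R.at_ x) : R.MatrixAt (fun ζ => shift (A ζ) (μ ζ)) x :=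
  fun a b => (R.at_ x).sub_mem ((R.at_ x).mul_mem hμ (R.const_mem _ x)) (hA a b)

theorem MatrixAt.det {A : X → Matrix (Fin n) (Fin n) ℂ} (hA : R.MatrixAt A x) :
    (fun ζ => (A ζ).det) ∈ R.at_ x := by
  obtain ⟨L, hL⟩ := hA.exists_lift
  have : (fun ζ => (A ζ).det) = L.det.1 := by
    funext ζ
    rw [← hL ζ, ← RingHom.map_det]
    rfl
  rw [this]
  exact L.det.2

theorem MatrixAt.charpoly_coeff {A : X → Matrix (Fin n) (Fin n) ℂ} (hA : R.MatrixAt A x) (i : ℕ) :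
    (fun ζ => (A ζ).charpoly.coeff i) ∈ R.at_ x := by
  obtain ⟨L, hL⟩ := hA.exists_lift
  have : (fun ζ => (A ζ).charpoly.coeff i) = (L.charpoly.coeff i).1 := by
    funext ζ
    rw [← hL ζ, RingHom.mapMatrix_apply, Matrix.charpoly_map, Polynomial.coeff_map]
    rfl
  rw [this]
  exact (L.charpoly.coeff i).2

theorem MatrixAt.inv {A : X → Matrix (Fin n) (Fin n) ℂ} (hA : R.MatrixAt A x)
    (h : (A x).det ≠ 0) : R.MatrixAt (fun ζ => (A ζ)⁻¹) x := by
  have hadj : R.MatrixAt (fun ζ => (A ζ).adjugate) x := by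
    obtain ⟨L, hL⟩ := hA.exists_lift
    exact matrixAt_of_lift L.adjugate fun ζ => by rw [RingHom.map_adjugate, hL]
  intro a b
  have : (fun ζ => (A ζ)⁻¹ a b) = (fun ζ => (A ζ).det)⁻¹ * fun ζ => (A ζ).adjugate a b := by
    funext ζ
    simp [Matrix.inv_def]
  rw [this]
  exact (R.at_ x).mul_mem (R.inv hA.det h) (hadj a b)

theorem MatrixAt.mulVec {A : X → Matrix (Fin n) (Fin n) ℂ} (hA : R.MatrixAt A x)
    {v : X → Fin n → ℂ} (hv : ∀ a, (fun ζ => v ζ a) ∈ R.at_ x) (a : Fin n) :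
    (fun ζ => (A ζ).mulVec (v ζ) a) ∈ R.at_ x := by
  have : (fun ζ => (A ζ).mulVec (v ζ) a) = ∑ b, (fun ζ => A ζ a b) * fun ζ => v ζ b := by
    funext ζ
    simp [Matrix.mulVec, dotProduct]
  rw [this]
  exact (R.at_ x).sum_mem fun b _ => (R.at_ x).mul_mem (hA a b) (hv b)

theorem MatrixAt.continuousAt {A : X → Matrix (Fin n) (Fin n) ℂ} (hA : R.MatrixAt A x) :
    ContinuousAt A x :=
  continuousAt_pi.mpr fun a => continuousAt_pi.mpr fun b => R.continuousAt (hA a b)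

theorem MatrixAt.eventually_isUnit {A : X → Matrix (Fin n) (Fin n) ℂ} (hA : R.MatrixAt A x)
    (h : IsUnit (A x)) : ∀ᶠ ζ in 𝓝 x, IsUnit (A ζ) := by
  have h1 : (A x).det ≠ 0 := ((Matrix.isUnit_iff_isUnit_det _).mp h).ne_zero
  filter_upwards [(R.continuousAt hA.det).eventually_ne h1] with ζ hζ
  exact (Matrix.isUnit_iff_isUnit_det _).mpr (isUnit_iff_ne_zero.mpr hζ)

end RegularityClass

/-- The kernel dimension is upper semicontinuous. -/
theorem eventually_nullity_le {X : Type*} [TopologicalSpace X] {n : ℕ} {x : X}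
    {M : X → Matrix (Fin n) (Fin n) ℂ} {R : RegularityClass X} (hM : R.MatrixAt M x) :
    ∀ᶠ ζ in 𝓝 x, nullity (M ζ) ≤ nullity (M x) := by
  obtain ⟨B, hu, hB⟩ := exists_isUnit_add (M x)
  filter_upwards [(hM.add (RegularityClass.MatrixAt.const B)).eventually_isUnit hu] with ζ hζ
  exact (nullity_le_rank_of_isUnit_add hζ).trans hB

/-- If the kernel dimension is constant, a vector in the kernel extends to a regular section. -/
theorem exists_kernel_section {X : Type*} [TopologicalSpace X] {n : ℕ} {x : X}
    {M : X → Matrix (Fin n) (Fin n) ℂ} (R : RegularityClass X)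
    (hM : ∀ᶠ ζ in 𝓝 x, R.MatrixAt M ζ) (hn : ∀ᶠ ζ in 𝓝 x, nullity (M ζ) = nullity (M x))
    (v : Fin n → ℂ) (hv : (M x).mulVec v = 0) :
    ∃ u : X → Fin n → ℂ, u x = v ∧
      ∀ᶠ ζ in 𝓝 x, (M ζ).mulVec (u ζ) = 0 ∧ ∀ a, (fun ζ => u ζ a) ∈ R.at_ ζ := by
  obtain ⟨B, hu, hB⟩ := exists_isUnit_add (M x)
  -- The fixed vector `v` is projected onto the kernel of `M ζ`, with the same `B` for all `ζ`;
  -- constancy of the nullity keeps the rank of `B` admissible.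
  refine ⟨fun ζ => v - (M ζ + B)⁻¹.mulVec ((M ζ).mulVec v), by simp [hv], ?_⟩
  have hG := hM.mono fun ζ h => h.add (RegularityClass.MatrixAt.const B)
  filter_upwards [hM, hn, hG, hG.self_of_nhds.eventually_isUnit hu] with ζ h1 h2 h3 h4
  refine ⟨mulVec_sub_inv_mulVec_eq_zero h4 (hB.trans h2.ge) v, fun a => ?_⟩
  refine (R.at_ ζ).sub_mem (R.const_mem _ _) ?_
  refine (h3.inv ((Matrix.isUnit_iff_isUnit_det _).mp h4).ne_zero).mulVec ?_ a
  exact h1.mulVec fun b => R.const_mem _ _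

/-! ### Equivalence of the constancy conditions and Jordanization -/

section Equivalences

variable {X : Type*} [TopologicalSpace X] {n m : ℕ} {A : X → Matrix (Fin n) (Fin n) ℂ} {ξ : X}
  {w : Fin m → ℂ} {U : Set X} {lam : Fin m → X → ℂ}

theorem onNhdWithin_of_eventually (hU : IsOpen U) (hξ : ξ ∈ U) {p : X → Prop}
    (h : ∀ᶠ ζ in 𝓝 ξ, p ζ) : OnNhdWithin U ξ fun V => ∀ ζ ∈ V, p ζ := by
  obtain ⟨V, hV, hVo, hVξ⟩ := eventually_nhds_iff.mp h
  exact ⟨V ∩ U, hVo.inter hU, ⟨hVξ, hξ⟩, inter_subset_right, fun ζ hζ => hV ζ hζ.1⟩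

theorem OnNhdWithin.eventually {P : Set X → Prop} {p : X → Prop} (h : OnNhdWithin U ξ P)
    (hp : ∀ V, ξ ∈ V → P V → ∀ ζ ∈ V, p ζ) : ∀ᶠ ζ in 𝓝 ξ, p ζ := by
  obtain ⟨V, hVo, hVξ, -, hV⟩ := h
  filter_upwards [hVo.mem_nhds hVξ] with ζ hζ using hp V hVξ hV ζ hζ

theorem OnNhdWithin.mono {P Q : Set X → Prop} (h : OnNhdWithin U ξ P) (hPQ : ∀ V, P V → Q V) :
    OnNhdWithin U ξ Q := by
  obtain ⟨V, hVo, hVξ, hVU, hV⟩ := h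
  exact ⟨V, hVo, hVξ, hVU, hPQ V hV⟩

/-- Near `ξ`, the kernels of all powers of `λ_j(ζ) - A(ζ)` have the same dimensions as at `ξ`. -/
def BranchNullitiesConstant (A : X → Matrix (Fin n) (Fin n) ℂ) (ξ : X) (lam : Fin m → X → ℂ) :
    Prop :=
  ∀ᶠ ζ in 𝓝 ξ, ∀ j k,
    nullity (shift (A ζ) (lam j ζ) ^ k) = nullity (shift (A ξ) (lam j ξ) ^ k)

/-- From exponent `n` on, the kernel dimension is the algebraic multiplicity, constant along a
branch; hence ranks need only be controlled up to `n - 1`. -/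
theorem IsEigenvalueBranches.nullity_eq_of_le (h : IsEigenvalueBranches A ξ w U lam)
    (hξ : ξ ∈ U) {ζ : X} (hζ : ζ ∈ U) (j : Fin m) {k : ℕ} (hk : n ≤ k) :
    nullity (shift (A ζ) (lam j ζ) ^ k) = nullity (shift (A ξ) (lam j ξ) ^ k) := by
  rw [nullity_shift_pow_of_le _ _ hk, nullity_shift_pow_of_le _ _ hk, h.algMult_eq ζ hζ,
    h.algMult_eq ξ hξ]

theorem nullity_eq_iff_rank_eq (M N : Matrix (Fin n) (Fin n) ℂ) :
    nullity M = nullity N ↔ M.rank = N.rank := by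
  have h1 := rank_add_nullity M
  have h2 := rank_add_nullity N
  omega

theorem branchRanksConstant_iff (h : IsEigenvalueBranches A ξ w U lam) (hU : IsOpen U)
    (hξ : ξ ∈ U) : BranchRanksConstant A ξ U lam ↔ BranchNullitiesConstant A ξ lam := by
  constructor
  · intro hr
    have h1 := hr.eventually (p := fun ζ => ∀ (j : Fin m) (k : ℕ), 1 ≤ k → k ≤ n - 1 →
      (shift (A ζ) (lam j ζ) ^ k).rank = (shift (A ξ) (lam j ξ) ^ k).rank)
      fun V hV hc ζ hζ j k hk hk' => hc j k hk hk' ζ hζ ξ hV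
    filter_upwards [h1, hU.mem_nhds hξ] with ζ hζ hζU j k
    rcases Nat.eq_zero_or_pos k with rfl | hk
    · simp
    · by_cases hk' : k ≤ n - 1
      · exact (nullity_eq_iff_rank_eq _ _).mpr (hζ j k hk hk')
      · exact h.nullity_eq_of_le hξ hζU j (by omega)
  · intro hN
    refine (onNhdWithin_of_eventually hU hξ hN).mono fun V hV j k _ _ x hx y hy => ?_
    exact (nullity_eq_iff_rank_eq _ _).mp ((hV x hx j k).trans (hV y hy j k).symm)

theorem branchBlockCountsConstant_iff (hU : IsOpen U) (hξ : ξ ∈ U) :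
    BranchBlockCountsConstant A ξ U lam ↔ BranchNullitiesConstant A ξ lam := by
  constructor
  · intro hr
    refine hr.eventually fun V hV hc ζ hζ j k => ?_
    rw [nullity_eq_sum_vartheta, nullity_eq_sum_vartheta]
    refine Finset.sum_congr rfl fun ℓ hℓ => ?_
    rw [Finset.mem_Icc] at hℓ
    exact congrArg _ (hc j ℓ hℓ.1 hℓ.2 ζ hζ ξ hV)
  · intro hN
    refine (onNhdWithin_of_eventually hU hξ hN).mono fun V hV j ℓ hℓ _ x hx y hy => ?_
    obtain ⟨ℓ, rfl⟩ := Nat.exists_eq_add_of_le' hℓ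
    have h1 := vartheta_add_nullity_add_nullity (A x) (lam j x) ℓ
    have h2 := vartheta_add_nullity_add_nullity (A y) (lam j y) ℓ
    rw [hV x hx, hV x hx, hV x hx] at h1
    rw [hV y hy, hV y hy, hV y hy] at h2
    change vartheta (ℓ + 1) (A x) (lam j x) = vartheta (ℓ + 1) (A y) (lam j y)
    omega

theorem IsEigenvalueBranches.sum_eigenvalues (h : IsEigenvalueBranches A ξ w U lam) {ζ : X}
    (hζ : ζ ∈ U) (f : ℂ → ℕ) : ∑ μ ∈ eigenvalues (A ζ), f μ = ∑ j, f (lam j ζ) := by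
  classical
  have h1 : eigenvalues (A ζ) = Finset.univ.image fun j => lam j ζ := by
    ext μ
    simp [h.mem_iff ζ hζ]
  rw [h1, Finset.sum_image fun i _ j _ hij => h.injective ζ hζ hij]

theorem totalBlockCountsConstant_of_branch (h : IsEigenvalueBranches A ξ w U lam)
    (hb : BranchBlockCountsConstant A ξ U lam) : TotalBlockCountsConstant A ξ U := by
  obtain ⟨V, hVo, hVξ, hVU, hV⟩ := hb
  refine ⟨V, hVo, hVξ, hVU, fun ℓ hℓ hℓ' x hx y hy => ?_⟩
  change varthetaTotal ℓ (A x) = varthetaTotal ℓ (A y)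
  rw [varthetaTotal, varthetaTotal, h.sum_eigenvalues (hVU hx) (vartheta ℓ (A x)),
    h.sum_eigenvalues (hVU hy) (vartheta ℓ (A y))]
  exact Finset.sum_congr rfl fun j _ => hV j ℓ hℓ hℓ' x hx y hy

theorem nullity_bigTheta_pow_eq_sum_varthetaTotal (Φ : Matrix (Fin n) (Fin n) ℂ) (k : ℕ) :
    nullity (bigTheta Φ ^ k) = ∑ ℓ ∈ Finset.Icc 1 n, min k ℓ * varthetaTotal ℓ Φ := by
  rw [nullity_bigTheta_pow]
  simp only [nullity_eq_sum_vartheta, varthetaTotal, Finset.mul_sum]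
  exact Finset.sum_comm

theorem thetaRanksConstant_of_totalBlockCounts (h : TotalBlockCountsConstant A ξ U) :
    ThetaRanksConstant A ξ U := by
  refine h.mono fun V hV k _ _ x hx y hy => ?_
  refine (nullity_eq_iff_rank_eq _ _).mp ?_
  rw [nullity_bigTheta_pow_eq_sum_varthetaTotal, nullity_bigTheta_pow_eq_sum_varthetaTotal]
  refine Finset.sum_congr rfl fun ℓ hℓ => ?_
  rw [Finset.mem_Icc] at hℓ
  exact congrArg _ (hV ℓ hℓ.1 hℓ.2 x hx y hy)

theorem IsEigenvalueBranches.continuousAt (h : IsEigenvalueBranches A ξ w U lam) (hU : IsOpen U)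
    {ζ : X} (hζ : ζ ∈ U) (j : Fin m) : ContinuousAt (lam j) ζ :=
  (h.continuousOn j).continuousAt (hU.mem_nhds hζ)

/-- Each branch nullity can only drop near `ξ`, while their sum, the nullity of `Θ ^ k`, does not
change; so none of them drops. -/
theorem branchNullitiesConstant_of_thetaRanks (h : IsEigenvalueBranches A ξ w U lam)
    (hA : Continuous A) (hU : IsOpen U) (hξ : ξ ∈ U) (ht : ThetaRanksConstant A ξ U) :
    BranchNullitiesConstant A ξ lam := by
  have h1 := ht.eventually (p := fun ζ => ∀ k : ℕ, 1 ≤ k → k ≤ n - 1 →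
      (bigTheta (A ζ) ^ k).rank = (bigTheta (A ξ) ^ k).rank)
      fun V hV hc ζ hζ k hk hk' => hc k hk hk' ζ hζ ξ hV
  have hAR : (RegularityClass.continuous X).MatrixAt A ξ := fun a b =>
    ((continuous_id.matrix_elem a b).comp hA).continuousAt
  have h2 : ∀ᶠ ζ in 𝓝 ξ, ∀ (j : Fin m) (k : Fin n),
      nullity (shift (A ζ) (lam j ζ) ^ (k : ℕ)) ≤ nullity (shift (A ξ) (lam j ξ) ^ (k : ℕ)) := by
    refine eventually_all.mpr fun j => eventually_all.mpr fun k => ?_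
    exact eventually_nullity_le ((hAR.shift (μ := lam j) (h.continuousAt hU hξ j)).pow k)
  filter_upwards [h1, h2, hU.mem_nhds hξ] with ζ hζ1 hζ2 hζU j k
  rcases Nat.eq_zero_or_pos k with rfl | hk
  · simp
  · by_cases hk' : k ≤ n - 1
    · have h3 := (nullity_eq_iff_rank_eq _ _).mpr (hζ1 k hk hk')
      rw [nullity_bigTheta_pow, nullity_bigTheta_pow,
        h.sum_eigenvalues hζU (fun μ => nullity (shift (A ζ) μ ^ k)),
        h.sum_eigenvalues hξ (fun μ => nullity (shift (A ξ) μ ^ k)),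
        Finset.sum_eq_sum_iff_of_le fun j _ => hζ2 j ⟨k, by omega⟩] at h3
      exact h3 j (Finset.mem_univ j)
    · exact h.nullity_eq_of_le hξ hζU j (by omega)

theorem chainMatrix_withEig_apply (D : JordanData n) (μ : Fin D.r → ℂ)
    (Φ : Matrix (Fin n) (Fin n) ℂ) (v : Fin D.r → Fin n → ℂ) (k p : Fin n) :
    chainMatrix (D.withEig μ) Φ v k p = ((-shift Φ (μ (D.index.symm p).1)) ^
      (D.size (D.index.symm p).1 - 1 - (D.index.symm p).2)).mulVec (v (D.index.symm p).1) k := rfl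

/-- Regular Jordanization from constant kernel dimensions. -/
theorem exists_jordanization (R : RegularityClass X) (h : IsEigenvalueBranches A ξ w U lam)
    (hU : IsOpen U) (hξ : ξ ∈ U) (hA : ∀ ζ, R.MatrixAt A ζ)
    (hlam : ∀ j, ∀ ζ ∈ U, lam j ∈ R.at_ ζ) (hN : BranchNullitiesConstant A ξ lam) :
    OnNhdWithin U ξ fun V => ∃ T : X → GL (Fin n) ℂ,
      (∀ ζ ∈ V, R.MatrixAt (fun ζ => (T ζ).val) ζ) ∧ Jordanizes T A V := by
  obtain ⟨D, v, hv, hu⟩ := exists_chainMatrix_isUnit (A ξ)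
  have hD : IsJordanFormOf D (A ξ) :=
    ⟨hu.unit, isJordanFormOf_of_mul_eq D _ hu.unit (mul_chainMatrix D _ v hv)⟩
  have hj : ∀ i, ∃ j, lam j ξ = D.eig i := fun i =>
    (h.mem_iff ξ hξ _).mp (mem_eigenvalues_of_isJordanFormOf hD i)
  choose j hj using hj
  have hUn := hU.mem_nhds hξ
  have hsec : ∀ i, ∃ u : X → Fin n → ℂ, u ξ = v i ∧ ∀ᶠ ζ in 𝓝 ξ,
      (shift (A ζ) (lam (j i) ζ) ^ D.size i).mulVec (u ζ) = 0 ∧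
        ∀ a, (fun ζ => u ζ a) ∈ R.at_ ζ := by
    intro i
    refine exists_kernel_section (M := fun ζ => shift (A ζ) (lam (j i) ζ) ^ D.size i) R ?_ ?_ (v i) ?_
    · filter_upwards [hUn] with ζ hζ using ((hA ζ).shift (hlam _ ζ hζ)).pow _
    · filter_upwards [hN] with ζ hζ using hζ _ _
    · rw [hj]; exact hv i
  choose u hu0 hus using hsec
  -- The block sizes stay those at `ξ`, and the eigenvalue of each block follows its branch.
  let D' : X → JordanData n := fun ζ => D.withEig fun i => lam (j i) ζ
  let C : X → Matrix (Fin n) (Fin n) ℂ := fun ζ => chainMatrix (D' ζ) (A ζ) fun i => u i ζ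
  have hCξ : IsUnit (C ξ) := by
    have h1 : C ξ = chainMatrix D (A ξ) v := by
      ext k p
      refine (chainMatrix_withEig_apply D _ _ _ k p).trans ?_
      rw [hj, hu0]
      rfl
    rwa [h1]
  have hCreg : ∀ᶠ ζ in 𝓝 ξ, R.MatrixAt C ζ := by
    filter_upwards [hUn, eventually_all.mpr hus] with ζ hζ hζu k p
    have h1 := (((hA ζ).shift (hlam (j (D.index.symm p).1) ζ hζ)).neg.pow
      (D.size (D.index.symm p).1 - 1 - (D.index.symm p).2)).mulVec (hζu (D.index.symm p).1).2 k
    exact h1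
  have hCu : ∀ᶠ ζ in 𝓝 ξ, IsUnit (C ζ) := hCreg.self_of_nhds.eventually_isUnit hCξ
  classical
  -- The default 1 is harmless: `T` agrees with `C` near `ξ`, and regularity is local.
  let T : X → GL (Fin n) ℂ := fun ζ => if hc : IsUnit (C ζ) then hc.unit else 1
  have hT : ∀ ζ, IsUnit (C ζ) → (T ζ).val = C ζ := fun ζ hc => by simp [T, dif_pos hc]
  have hfin : ∀ᶠ ζ in 𝓝 ξ, R.MatrixAt (fun ζ => (T ζ).val) ζ ∧
      IsJordanNormal (((T ζ)⁻¹ : GL (Fin n) ℂ).val * A ζ * (T ζ).val) := by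
    filter_upwards [hCreg, hCu, eventually_eventually_nhds.mpr hCu, eventually_all.mpr hus]
      with ζ h1 h2 h3 h4
    refine ⟨fun a b => R.congr (h1 a b) ?_, D' ζ, ?_⟩
    · filter_upwards [h3] with η hη
      rw [hT η hη]
    · refine (isJordanFormOf_of_mul_eq (D' ζ) (A ζ) (T ζ) ?_).symm
      rw [hT ζ h2]
      exact mul_chainMatrix (D' ζ) (A ζ) (fun i => u i ζ) fun i => (h4 i).1
  refine (onNhdWithin_of_eventually hU hξ hfin).mono fun V hV => ⟨T, ?_, ?_⟩
  · exact fun ζ hζ => (hV ζ hζ).1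
  · exact fun ζ hζ => (hV ζ hζ).2

theorem JordanData.toMatrix_apply_self (D : JordanData n) (p : Fin n) :
    D.toMatrix p p = D.eig (D.index.symm p).1 := by
  obtain ⟨x, rfl⟩ := D.index.surjective p
  rw [D.toMatrix_apply_index, Equiv.symm_apply_apply, Matrix.blockDiagonal'_apply_eq]
  simp [jordanBlock]

theorem JordanData.toMatrix_withEig_of_ne (D : JordanData n) (μ : Fin D.r → ℂ) {p q : Fin n}
    (hpq : p ≠ q) : (D.withEig μ).toMatrix p q = D.toMatrix p q := by
  obtain ⟨⟨i, a⟩, rfl⟩ := D.index.surjective p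
  obtain ⟨⟨j, b⟩, rfl⟩ := D.index.surjective q
  rw [D.toMatrix_apply_index]
  refine ((D.withEig μ).toMatrix_apply_index ⟨i, a⟩ ⟨j, b⟩).trans ?_
  by_cases hij : i = j
  · subst hij
    have hab : a ≠ b := fun h => hpq (by rw [h])
    refine (Matrix.blockDiagonal'_apply_eq _ _ _ _).trans ?_
    rw [Matrix.blockDiagonal'_apply_eq]
    change jordanBlock _ (D.size i) a b = _
    simp [jordanBlock, hab]
  · rw [Matrix.blockDiagonal'_apply_ne _ _ _ hij]
    exact Matrix.blockDiagonal'_apply_ne _ _ _ hij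

theorem JordanData.toMatrix_of_ne (D : JordanData n) {p q : Fin n} (hpq : p ≠ q) :
    D.toMatrix p q = 0 ∨ D.toMatrix p q = 1 := by
  obtain ⟨⟨i, a⟩, rfl⟩ := D.index.surjective p
  obtain ⟨⟨j, b⟩, rfl⟩ := D.index.surjective q
  rw [D.toMatrix_apply_index]
  by_cases hij : i = j
  · subst hij
    have hab : a ≠ b := fun h => hpq (by rw [h])
    rw [Matrix.blockDiagonal'_apply_eq]
    by_cases h : (a : ℕ) + 1 = b <;> simp [jordanBlock, hab, h]
  · exact Or.inl (Matrix.blockDiagonal'_apply_ne _ _ _ hij)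

/-- Continuity freezes the 0-1 off-diagonal pattern and keeps each diagonal entry on a single
branch, so near `ξ` the Jordan matrix is the one at `ξ` with eigenvalues moved along the branches.
-/
theorem branchNullitiesConstant_of_continuousJordanization
    (h : IsEigenvalueBranches A ξ w U lam) (hA : Continuous A) (hU : IsOpen U) (hξ : ξ ∈ U)
    (hJ : ContinuousJordanization A ξ U) : BranchNullitiesConstant A ξ lam := by
  obtain ⟨V, hVo, hVξ, hVU, T, hTc, hTJ⟩ := hJ
  let J : X → Matrix (Fin n) (Fin n) ℂ := fun ζ =>
    ((T ζ)⁻¹ : GL (Fin n) ℂ).val * A ζ * (T ζ).val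
  have hV : V ∈ 𝓝 ξ := hVo.mem_nhds hVξ
  have hTξ : ContinuousAt T ξ := hTc.continuousAt hV
  have hJc : ContinuousAt J ξ :=
    (((Units.continuous_val.continuousAt.comp hTξ.inv).mul hA.continuousAt).mul
      (Units.continuous_val.continuousAt.comp hTξ))
  have hJpq : ∀ p q, ContinuousAt (fun ζ => J ζ p q) ξ := fun p q =>
    continuousAt_pi.mp (continuousAt_pi.mp hJc p) q
  have hform : ∀ ζ ∈ V, ∃ D : JordanData n, D.toMatrix = J ζ ∧ IsJordanFormOf D (A ζ) :=
    fun ζ hζ => by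
      obtain ⟨D, hD⟩ := hTJ ζ hζ
      exact ⟨D, hD, T ζ, hD.symm⟩
  obtain ⟨D, hD, hDf⟩ := hform ξ hVξ
  have hj : ∀ i, ∃ j, lam j ξ = D.eig i := fun i =>
    (h.mem_iff ξ hξ _).mp (mem_eigenvalues_of_isJordanFormOf hDf i)
  choose j hj using hj
  let D' : X → JordanData n := fun ζ => D.withEig fun i => lam (j i) ζ
  have hoff : ∀ p q, p ≠ q → ∀ᶠ ζ in 𝓝 ξ, J ζ p q = (D' ζ).toMatrix p q := by
    intro p q hpq
    have hval : ∀ ζ ∈ V, J ζ p q = 0 ∨ J ζ p q = 1 := by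
      intro ζ hζ
      obtain ⟨Dζ, hDζ, -⟩ := hform ζ hζ
      rw [← hDζ]
      exact Dζ.toMatrix_of_ne hpq
    have heq : ∀ ζ, (D' ζ).toMatrix p q = J ξ p q := fun ζ => by
      rw [D.toMatrix_withEig_of_ne _ hpq, hD]
    rcases hval ξ hVξ with h0 | h0
    · filter_upwards [hV, (hJpq p q).eventually_ne (h0.trans_ne zero_ne_one)] with ζ hζ hne
      rw [heq, h0]
      exact (hval ζ hζ).resolve_right hne
    · filter_upwards [hV, (hJpq p q).eventually_ne (h0.trans_ne one_ne_zero)] with ζ hζ hne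
      rw [heq, h0]
      exact (hval ζ hζ).resolve_left hne
  have hdiag : ∀ p, ∀ᶠ ζ in 𝓝 ξ, J ζ p p = (D' ζ).toMatrix p p := by
    intro p
    have heq : ∀ ζ, (D' ζ).toMatrix p p = lam (j (D.index.symm p).1) ζ := fun ζ =>
      (D' ζ).toMatrix_apply_self p
    -- A diagonal entry is always some eigenvalue; continuity rules out all branches but the one it
    -- equals at `ξ`.
    have hne : ∀ᶠ ζ in 𝓝 ξ, ∀ i, i ≠ j (D.index.symm p).1 → J ζ p p - lam i ζ ≠ 0 := by
      refine eventually_all.mpr fun i => ?_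
      by_cases hi : i = j (D.index.symm p).1
      · exact Eventually.of_forall fun ζ hne => (hne hi).elim
      · have h1 : J ξ p p - lam i ξ ≠ 0 := by
          rw [← hD, D.toMatrix_apply_self, ← hj, sub_ne_zero]
          exact fun h' => hi (h.injective ξ hξ h').symm
        filter_upwards [((hJpq p p).sub (h.continuousAt hU hξ i)).eventually_ne h1] with ζ hζ _
        exact hζ
    filter_upwards [hV, hne] with ζ hζ hζne
    obtain ⟨Dζ, hDζ, hDζf⟩ := hform ζ hζ
    obtain ⟨i, hi⟩ := (h.mem_iff ζ (hVU hζ) _).mp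
      (mem_eigenvalues_of_isJordanFormOf hDζf (Dζ.index.symm p).1)
    rw [← Dζ.toMatrix_apply_self, hDζ] at hi
    rw [heq]
    by_cases hij : i = j (D.index.symm p).1
    · rw [← hij, hi]
    · exact (hζne i hij (sub_eq_zero.mpr hi.symm)).elim
  have hall : ∀ᶠ ζ in 𝓝 ξ, J ζ = (D' ζ).toMatrix := by
    have h1 : ∀ᶠ ζ in 𝓝 ξ, ∀ p q, J ζ p q = (D' ζ).toMatrix p q := by
      refine eventually_all.mpr fun p => eventually_all.mpr fun q => ?_
      by_cases hpq : p = q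
      · subst hpq; exact hdiag p
      · exact hoff p q hpq
    filter_upwards [h1] with ζ hζ
    ext p q
    exact hζ p q
  -- The right side no longer involves `ζ`: distinctness of the branches turns equality of
  -- eigenvalues into equality of labels.
  have hnul : ∀ᶠ ζ in 𝓝 ξ, ∀ (i : Fin m) (k : ℕ),
      nullity (shift (A ζ) (lam i ζ) ^ k) = ∑ b with j b = i, min k (D.size b) := by
    filter_upwards [hall, hU.mem_nhds hξ] with ζ hζ hζU i k
    have h1 : IsJordanFormOf (D' ζ) (A ζ) := ⟨T ζ, hζ⟩
    rw [nullity_shift_pow_of_isJordanFormOf h1, Finset.sum_filter, Finset.sum_filter]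
    exact Finset.sum_congr rfl fun b _ => if_congr (h.injective ζ hζU).eq_iff rfl rfl
  filter_upwards [hnul] with ζ hζ i k
  rw [hζ, hnul.self_of_nhds]

/-- The topology of the unit group is induced by `T ↦ (T, T⁻¹)`, so continuity of the inverse is
needed too; it comes from the adjugate formula. -/
theorem continuousAt_generalLinearGroup {R : RegularityClass X} {T : X → GL (Fin n) ℂ} {ζ : X}
    (hT : R.MatrixAt (fun ζ => (T ζ).val) ζ) : ContinuousAt T ζ := by
  have hdet : (T ζ).val.det ≠ 0 := ((Matrix.isUnit_iff_isUnit_det _).mp (T ζ).isUnit).ne_zero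
  have hinv : R.MatrixAt (fun ζ => ((T ζ)⁻¹ : GL (Fin n) ℂ).val) ζ := by
    have := hT.inv hdet
    simpa only [Matrix.coe_units_inv] using this
  rw [ContinuousAt, Units.isInducing_embedProduct.tendsto_nhds_iff]
  exact (hT.continuousAt).prodMk_nhds
    (MulOpposite.continuous_op.continuousAt.comp hinv.continuousAt)

end Equivalences

/-! ### Existence and uniqueness of eigenvalue branches -/

section Branches

variable {X : Type*} [TopologicalSpace X] {n m : ℕ} {A : X → Matrix (Fin n) (Fin n) ℂ} {ξ : X}
  {w : Fin m → ℂ} {U : Set X} {lam : Fin m → X → ℂ}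

theorem pow_le_norm_multiset_prod {ε : ℝ} (hε : 0 ≤ ε) (s : Multiset ℂ) (h : ∀ z ∈ s, ε ≤ ‖z‖) :
    ε ^ s.card ≤ ‖s.prod‖ := by
  induction s using Multiset.induction_on with
  | empty => simp
  | cons a s ih =>
    rw [Multiset.card_cons, pow_succ', Multiset.prod_cons, norm_mul]
    exact mul_le_mul (h a (Multiset.mem_cons_self a s))
      (ih fun z hz => h z (Multiset.mem_cons_of_mem hz)) (by positivity) (norm_nonneg a)

theorem card_roots_charpoly (Φ : Matrix (Fin n) (Fin n) ℂ) : Φ.charpoly.roots.card = n := by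
  rw [← (IsAlgClosed.splits Φ.charpoly).natDegree_eq_card_roots, Matrix.charpoly_natDegree_eq_dim,
    Fintype.card_fin]

/-- The value of the characteristic polynomial is a product of `n` factors `μ - ν`; were all of
modulus at least `ε`, it would have modulus at least `ε ^ n`. -/
theorem exists_eigenvalue_norm_lt (Φ : Matrix (Fin n) (Fin n) ℂ) (μ : ℂ) {ε : ℝ} (hε : 0 ≤ ε)
    (h : ‖Φ.charpoly.eval μ‖ < ε ^ n) : ∃ ν ∈ eigenvalues Φ, ‖μ - ν‖ < ε := by
  by_contra! hcon
  refine h.not_ge ?_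
  rw [(IsAlgClosed.splits Φ.charpoly).eval_eq_prod_roots_of_monic Φ.charpoly_monic]
  have h1 := pow_le_norm_multiset_prod hε (Φ.charpoly.roots.map fun a => μ - a) (by
    intro z hz
    obtain ⟨ν, hν, rfl⟩ := Multiset.mem_map.mp hz
    exact hcon ν ((mem_eigenvalues_iff_isRoot Φ ν).mpr (Polynomial.isRoot_of_mem_roots hν)))
  rwa [Multiset.card_map, card_roots_charpoly] at h1

/-- Eigenvalues persist under small perturbations. -/
theorem eventually_exists_eigenvalue (hA : Continuous A) {μ : ℂ} (hμ : μ ∈ eigenvalues (A ξ))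
    {O : Set ℂ} (hO : O ∈ 𝓝 μ) : ∀ᶠ ζ in 𝓝 ξ, ∃ ν ∈ eigenvalues (A ζ), ν ∈ O := by
  obtain ⟨ε, hε, hεO⟩ := Metric.mem_nhds_iff.mp hO
  have hc : Continuous fun ζ => ‖(A ζ).charpoly.eval μ‖ := by
    simp only [Matrix.eval_charpoly]
    exact (continuous_const.sub hA).matrix_det.norm
  have h0 : ‖(A ξ).charpoly.eval μ‖ < ε ^ n := by
    rw [(mem_eigenvalues_iff_isRoot _ _).mp hμ, norm_zero]
    positivity
  filter_upwards [hc.continuousAt.eventually_lt_const h0] with ζ hζ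
  obtain ⟨ν, hν, hd⟩ := exists_eigenvalue_norm_lt (A ζ) μ hε.le hζ
  exact ⟨ν, hν, hεO (by rwa [mem_ball_iff_norm'])⟩

theorem sum_algMult_eigenvalues (Φ : Matrix (Fin n) (Fin n) ℂ) :
    ∑ μ ∈ eigenvalues Φ, algMult Φ μ = n := by
  classical
  have h1 : eigenvalues Φ = Φ.charpoly.roots.toFinset := by
    ext μ
    rw [mem_eigenvalues_iff_isRoot, Multiset.mem_toFinset,
      Polynomial.mem_roots Φ.charpoly_monic.ne_zero]
  rw [h1]
  simp only [algMult, ← Polynomial.count_roots]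
  rw [Multiset.toFinset_sum_count_eq, card_roots_charpoly]

/-- Disjoint open sets around the `w j` each keep an eigenvalue near `ξ`, and without splitting
there are at most `m` in all, so each contains exactly one. -/
theorem exists_eigenvalueBranches (hA : Continuous A) (hξ : ¬ IsSplittingPoint A ξ)
    (hw : Function.Injective w) (hw_eig : ∀ μ : ℂ, μ ∈ eigenvalues (A ξ) ↔ ∃ j, w j = μ) :
    ∃ U₀ : Set X, IsOpen U₀ ∧ ξ ∈ U₀ ∧
      ∃ lam : Fin m → X → ℂ, IsEigenvalueBranches A ξ w U₀ lam := by
  classical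
  obtain ⟨U₁, hU₁, hcard⟩ : ∃ U ∈ 𝓝 ξ, ∀ ζ ∈ U,
      (eigenvalues (A ζ)).card ≤ (eigenvalues (A ξ)).card := by
    simpa only [IsSplittingPoint, not_forall, not_exists, not_and, not_lt, exists_prop] using hξ
  have hm : (eigenvalues (A ξ)).card = m := by
    have h1 : eigenvalues (A ξ) = Finset.univ.image w := by
      ext μ
      simp [hw_eig]
    rw [h1, Finset.card_image_of_injective _ hw, Finset.card_univ, Fintype.card_fin]
  obtain ⟨O', hO', hdisj⟩ := (Set.finite_range w).t2_separation
  let O : Fin m → Set ℂ := fun j => O' (w j)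
  have hOn : ∀ j, O j ∈ 𝓝 (w j) := fun j => (hO' (w j)).2.mem_nhds (hO' (w j)).1
  have hOd : ∀ {i j μ}, μ ∈ O i → μ ∈ O j → i = j := by
    intro i j μ hi hj
    by_contra hij
    exact Set.disjoint_left.mp (hdisj (mem_range_self i) (mem_range_self j) (hw.ne hij)) hi hj
  have hex : ∀ᶠ ζ in 𝓝 ξ, ∀ j, ∃ ν ∈ eigenvalues (A ζ), ν ∈ O j := eventually_all.mpr fun j =>
    eventually_exists_eigenvalue hA ((hw_eig _).mpr ⟨j, rfl⟩) (hOn j)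
  let lam : Fin m → X → ℂ := fun j ζ =>
    if h : ∃ ν ∈ eigenvalues (A ζ), ν ∈ O j then h.choose else 0
  have hlam : ∀ ζ j, (∃ ν ∈ eigenvalues (A ζ), ν ∈ O j) →
      lam j ζ ∈ eigenvalues (A ζ) ∧ lam j ζ ∈ O j := by
    intro ζ j h
    simp only [lam, dif_pos h]
    exact h.choose_spec
  obtain ⟨V, hV, hVo, hVξ⟩ := eventually_nhds_iff.mp (hex.and (eventually_mem_nhds_iff.mpr hU₁))
  have hinj : ∀ ζ ∈ V, Function.Injective fun j => lam j ζ := by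
    intro ζ hζ i j hij
    have h1 := (hlam ζ i ((hV ζ hζ).1 i)).2
    have h2 := (hlam ζ j ((hV ζ hζ).1 j)).2
    rw [show lam i ζ = lam j ζ from hij] at h1
    exact hOd h1 h2
  have himg : ∀ ζ ∈ V, Finset.univ.image (fun j => lam j ζ) = eigenvalues (A ζ) := by
    intro ζ hζ
    refine Finset.eq_of_subset_of_card_le ?_ ?_
    · intro μ hμ
      obtain ⟨j, -, rfl⟩ := Finset.mem_image.mp hμ
      exact (hlam ζ j ((hV ζ hζ).1 j)).1
    · rw [Finset.card_image_of_injective _ (hinj ζ hζ), Finset.card_univ, Fintype.card_fin, ← hm]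
      exact hcard ζ (mem_of_mem_nhds (hV ζ hζ).2)
  have hmem : ∀ ζ ∈ V, ∀ μ : ℂ, μ ∈ eigenvalues (A ζ) ↔ ∃ j, lam j ζ = μ := by
    intro ζ hζ μ
    rw [← himg ζ hζ]
    simp
  have hone : ∀ ζ ∈ V, ∀ j, ∀ μ ∈ eigenvalues (A ζ), μ ∈ O j → lam j ζ = μ := by
    intro ζ hζ j μ hμ hμO
    obtain ⟨k, rfl⟩ := (hmem ζ hζ μ).mp hμ
    rw [hOd hμO (hlam ζ k ((hV ζ hζ).1 k)).2]
  have hcont : ∀ j, ∀ ζ ∈ V, ContinuousAt (lam j) ζ := by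
    intro j ζ hζ N hN
    have h1 := hlam ζ j ((hV ζ hζ).1 j)
    -- Persistence, now applied at `ζ`, puts an eigenvalue in `N` and in the separating set; by
    -- uniqueness there it is the branch value.
    have h2 := eventually_exists_eigenvalue hA h1.1
      (inter_mem hN ((hO' (w j)).2.mem_nhds h1.2))
    refine mem_map.mpr ?_
    filter_upwards [h2, hVo.mem_nhds hζ] with η hη hηV
    obtain ⟨ν, hν, hνN, hνO⟩ := hη
    rw [mem_preimage, hone η hηV j ν hν hνO]
    exact hνN
  have hbase : ∀ j, lam j ξ = w j := fun j =>
    hone ξ hVξ j (w j) ((hw_eig _).mpr ⟨j, rfl⟩) (mem_of_mem_nhds (hOn j))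
  have hsum : ∀ ζ ∈ V, ∑ j, algMult (A ζ) (lam j ζ) = n := by
    intro ζ hζ
    have h1 := sum_algMult_eigenvalues (A ζ)
    rwa [← himg ζ hζ, Finset.sum_image fun i _ j _ hij => hinj ζ hζ hij] at h1
  have hmult : ∀ᶠ ζ in 𝓝 ξ, ∀ j, algMult (A ζ) (lam j ζ) = algMult (A ξ) (w j) := by
    have hAR : (RegularityClass.continuous X).MatrixAt A ξ := fun a b =>
      ((continuous_id.matrix_elem a b).comp hA).continuousAt
    -- Multiplicities are nullities of `n`-th powers, hence upper semicontinuous; as their sum is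
    -- always `n`, equality follows.
    have hle : ∀ᶠ ζ in 𝓝 ξ, ∀ j, algMult (A ζ) (lam j ζ) ≤ algMult (A ξ) (lam j ξ) := by
      refine eventually_all.mpr fun j => ?_
      simp only [← nullity_shift_pow_of_le _ _ (le_refl n)]
      exact eventually_nullity_le ((hAR.shift (μ := lam j) (hcont j ξ hVξ)).pow n)
    filter_upwards [hle, hVo.mem_nhds hVξ] with ζ hζ hζV j
    rw [← hbase]
    exact (Finset.sum_eq_sum_iff_of_le fun j _ => hζ j).mp
      ((hsum ζ hζV).trans (hsum ξ hVξ).symm) j (Finset.mem_univ j)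
  obtain ⟨W, hW, hWo, hWξ⟩ := eventually_nhds_iff.mp hmult
  refine ⟨V ∩ W, hVo.inter hWo, ⟨hVξ, hWξ⟩, lam, ?_⟩
  exact
    { continuousOn := fun j ζ hζ => (hcont j ζ hζ.1).continuousWithinAt
      apply_base := hbase
      injective := fun ζ hζ => hinj ζ hζ.1
      mem_iff := fun ζ hζ => hmem ζ hζ.1
      algMult_eq := fun ζ hζ => hW ζ hζ.2 }

theorem IsEigenvalueBranches.mono {V : Set X} (h : IsEigenvalueBranches A ξ w U lam) (hV : V ⊆ U) :
    IsEigenvalueBranches A ξ w V lam where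
  continuousOn := fun j => (h.continuousOn j).mono hV
  apply_base := h.apply_base
  injective := fun ζ hζ => h.injective ζ (hV hζ)
  mem_iff := fun ζ hζ => h.mem_iff ζ (hV hζ)
  algMult_eq := fun ζ hζ => h.algMult_eq ζ (hV hζ)

/-- The agreement set is open and closed in `U`: near a point of agreement, `lam' j` is still some
eigenvalue, and continuity keeps it off the branches other than `lam j`. -/
theorem IsEigenvalueBranches.eqOn {lam' : Fin m → X → ℂ} (h : IsEigenvalueBranches A ξ w U lam)
    (h' : IsEigenvalueBranches A ξ w U lam') (hU : IsOpen U) (hξ : ξ ∈ U)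
    (hconn : IsPreconnected U) (j : Fin m) : EqOn (lam' j) (lam j) U := by
  have hu : IsOpen {ζ | ζ ∈ U ∧ lam' j ζ = lam j ζ} := by
    rw [isOpen_iff_mem_nhds]
    rintro ζ ⟨hζ, heq⟩
    have hne : ∀ᶠ η in 𝓝 ζ, ∀ k, k ≠ j → lam' j η - lam k η ≠ 0 := by
      refine eventually_all.mpr fun k => ?_
      by_cases hk : k = j
      · exact Eventually.of_forall fun _ hne => (hne hk).elim
      · have h1 : lam' j ζ - lam k ζ ≠ 0 := by
          rw [heq, sub_ne_zero]
          exact fun h2 => hk (h.injective ζ hζ h2).symm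
        filter_upwards [((h'.continuousAt hU hζ j).sub
          (h.continuousAt hU hζ k)).eventually_ne h1] with η hη _ using hη
    filter_upwards [hU.mem_nhds hζ, hne] with η hη hηne
    refine ⟨hη, ?_⟩
    obtain ⟨k, hk⟩ := (h.mem_iff η hη _).mp ((h'.mem_iff η hη _).mpr ⟨j, rfl⟩)
    by_cases hkj : k = j
    · rw [← hk, hkj]
    · exact (hηne k hkj (sub_eq_zero.mpr hk.symm)).elim
  have hv : IsOpen {ζ | ζ ∈ U ∧ lam' j ζ ≠ lam j ζ} := by
    rw [isOpen_iff_mem_nhds]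
    rintro ζ ⟨hζ, hne⟩
    filter_upwards [hU.mem_nhds hζ, ((h'.continuousAt hU hζ j).sub
      (h.continuousAt hU hζ j)).eventually_ne (sub_ne_zero.mpr hne)] with η hη hη'
    exact ⟨hη, sub_ne_zero.mp hη'⟩
  have hsub := hconn.subset_left_of_subset_union hu hv
    (Set.disjoint_left.mpr fun ζ h1 h2 => h2.2 h1.2)
    (fun ζ hζ => (em (lam' j ζ = lam j ζ)).imp (fun h => ⟨hζ, h⟩) fun h => ⟨hζ, h⟩)
    ⟨ξ, hξ, hξ, by rw [h.apply_base, h'.apply_base]⟩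
  exact fun ζ hζ => (hsub hζ).2

end Branches

/-! ### Holomorphic functions on complex spaces and holomorphy of the branches -/

section ComplexSpaces

variable {X : Type*} [TopologicalSpace X]

theorem AnalyticChart.continuousAt (c : AnalyticChart X) {x : X} (hx : x ∈ c.source) :
    ContinuousAt c.toFun x :=
  (continuousOn_iff_continuous_domRestrict.mpr c.isEmbedding.continuous).continuousAt
    (c.isOpen_source.mem_nhds hx)

namespace ComplexSpace

variable (S : ComplexSpace X)

/-- Near `x`, the function `f` is in a chart the restriction of a holomorphic function. -/
def HolomorphicAt (f : X → ℂ) (x : X) : Prop :=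
  ∃ c ∈ S.atlas, x ∈ c.source ∧
    ∃ F : (Fin c.N → ℂ) → ℂ, AnalyticAt ℂ F (c.toFun x) ∧ ∀ᶠ y in 𝓝 x, f y = F (c.toFun y)

variable {S}

/-- Holomorphy can be tested in any chart. -/
theorem HolomorphicAt.exists_in_chart {f : X → ℂ} {x : X} (h : S.HolomorphicAt f x)
    {c : AnalyticChart X} (hc : c ∈ S.atlas) (hx : x ∈ c.source) :
    ∃ F : (Fin c.N → ℂ) → ℂ, AnalyticAt ℂ F (c.toFun x) ∧ ∀ᶠ y in 𝓝 x, f y = F (c.toFun y) := by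
  obtain ⟨d, hd, hxd, G, hG, hfG⟩ := h
  obtain ⟨H, hH, hcd⟩ := S.compatible c hc d hd x ⟨hx, hxd⟩
  refine ⟨G ∘ H, AnalyticAt.comp (by rwa [← hcd.self_of_nhds]) hH, ?_⟩
  filter_upwards [hfG, hcd] with y h1 h2
  rw [h1, h2, Function.comp_apply]

theorem HolomorphicAt.map₂ {f g : X → ℂ} {x : X} (hf : S.HolomorphicAt f x)
    (hg : S.HolomorphicAt g x) (op : ℂ → ℂ → ℂ)
    (hop : ∀ {N : ℕ} {F G : (Fin N → ℂ) → ℂ} {p}, AnalyticAt ℂ F p → AnalyticAt ℂ G p →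
      AnalyticAt ℂ (fun z => op (F z) (G z)) p) :
    S.HolomorphicAt (fun y => op (f y) (g y)) x := by
  obtain ⟨c, hc, hx, F, hF, hfF⟩ := hf
  obtain ⟨G, hG, hgG⟩ := hg.exists_in_chart hc hx
  refine ⟨c, hc, hx, fun z => op (F z) (G z), hop hF hG, ?_⟩
  filter_upwards [hfF, hgG] with y h1 h2
  rw [h1, h2]

variable (S) in
/-- Holomorphy as a regularity class. -/
def regularityClass : RegularityClass X where
  at_ x :=
    { carrier := {f | S.HolomorphicAt f x}
      mul_mem' := fun hf hg => hf.map₂ hg (· * ·) fun hF hG => hF.mul hG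
      add_mem' := fun hf hg => hf.map₂ hg (· + ·) fun hF hG => hF.add hG
      algebraMap_mem' := fun r => by
        obtain ⟨c, hc, hx⟩ := S.cover x
        exact ⟨c, hc, hx, fun _ => r, analyticAt_const, Eventually.of_forall fun _ => rfl⟩ }
  congr := by
    rintro x f g ⟨c, hc, hx, F, hF, hfF⟩ hfg
    refine ⟨c, hc, hx, F, hF, ?_⟩
    filter_upwards [hfF, hfg] with y h1 h2
    rw [← h2, h1]
  inv := by
    rintro x f ⟨c, hc, hx, F, hF, hfF⟩ h0
    refine ⟨c, hc, hx, F⁻¹, hF.inv (by rwa [← hfF.self_of_nhds]), ?_⟩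
    filter_upwards [hfF] with y h1
    rw [Pi.inv_apply, Pi.inv_apply, h1]
  continuousAt := by
    rintro x f ⟨c, hc, hx, F, hF, hfF⟩
    exact (hF.continuousAt.comp (c.continuousAt hx)).congr (hfF.mono fun y hy => hy.symm)

theorem matrixHolomorphicOn_iff {n : ℕ} {A : X → Matrix (Fin n) (Fin n) ℂ} {U : Set X} :
    S.MatrixHolomorphicOn A U ↔ ∀ ζ ∈ U, S.regularityClass.MatrixAt A ζ :=
  ⟨fun h ζ hζ a b => h a b ζ hζ, fun h a b ζ hζ => h ζ hζ a b⟩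

open Polynomial in
/-- A continuous simple root of a polynomial with holomorphic coefficients is holomorphic. -/
theorem holomorphicAt_of_simple_root {q : X → ℂ[X]} {lam : X → ℂ} {x : X} {N : ℕ}
    (hdeg : ∀ y, (q y).natDegree < N) (hq : ∀ i, S.HolomorphicAt (fun y => (q y).coeff i) x)
    (hlam : ContinuousAt lam x) (hroot : ∀ᶠ y in 𝓝 x, (q y).eval (lam y) = 0)
    (hsimple : (derivative (q x)).eval (lam x) ≠ 0) : S.HolomorphicAt lam x := by
  obtain ⟨c, hc, hx⟩ := S.cover x
  choose F hF hqF using fun i => (hq i).exists_in_chart hc hx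
  set p := c.toFun x
  let G : (Fin c.N → ℂ) × ℂ → ℂ := fun v => ∑ i ∈ Finset.range N, F i v.1 * v.2 ^ i
  have hG : AnalyticAt ℂ G (p, lam x) := by
    refine Finset.analyticAt_fun_sum _ fun i _ => ?_
    exact (AnalyticAt.fun_comp (f := Prod.fst) (x := (p, lam x)) (hF i) analyticAt_fst).mul (analyticAt_snd.pow i)
  have heval : ∀ᶠ y in 𝓝 x, ∀ z, G (c.toFun y, z) = (q y).eval z := by
    have h1 : ∀ᶠ y in 𝓝 x, ∀ i ∈ Finset.range N, (q y).coeff i = F i (c.toFun y) :=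
      (Filter.eventually_all_finset _).mpr fun i _ => hqF i
    filter_upwards [h1] with y hy z
    rw [eval_eq_sum_range' (hdeg y)]
    exact Finset.sum_congr rfl fun i hi => by rw [hy i hi]
  have hGC : ContDiffAt ℂ ⊤ G (p, lam x) := hG.contDiffAt
  -- The partial derivative in the root variable is multiplication by the value in `hsimple`, so the
  -- implicit function theorem applies in the ambient space of the chart.
  have hinv : (fderiv ℂ G (p, lam x) ∘L .inr ℂ (Fin c.N → ℂ) ℂ).IsInvertible := by
    have h1 : HasFDerivAt (fun z => G (p, z))
        (fderiv ℂ G (p, lam x) ∘L .inr ℂ (Fin c.N → ℂ) ℂ) (lam x) :=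
      hG.differentiableAt.hasFDerivAt.comp (lam x) (hasFDerivAt_prodMk_right p (lam x))
    have h2 : HasDerivAt (fun z => G (p, z)) ((derivative (q x)).eval (lam x)) (lam x) := by
      have : (fun z => G (p, z)) = fun z => (q x).eval z := funext heval.self_of_nhds
      rw [this]
      exact (q x).hasDerivAt (lam x)
    rw [h1.unique h2.hasFDerivAt]
    exact ⟨ContinuousLinearEquiv.unitsEquivAut ℂ (Units.mk0 _ hsimple), by ext; simp⟩
  have htop : (⊤ : WithTop ℕ∞) ≠ 0 := by simp
  have hpsi := (hGC.contDiffAt_implicitFunction htop hinv)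
  refine ⟨c, hc, hx, hGC.implicitFunction htop hinv, hpsi.analyticAt, ?_⟩
  have htend : Tendsto (fun y => (c.toFun y, lam y)) (𝓝 x) (𝓝 (p, lam x)) :=
    (c.continuousAt hx).prodMk_nhds hlam
  filter_upwards [htend.eventually (hGC.eventually_apply_eq_iff_implicitFunction htop hinv),
    heval, hroot] with y h1 h2 h3
  -- The criterion compares `G` with its value at the base point; both vanish because `lam` is a
  -- root.
  refine (h1.mp ?_).symm
  rw [h2, h3, heval.self_of_nhds, hroot.self_of_nhds]

end ComplexSpace

open Polynomial in
/-- Eigenvalue branches of a holomorphic matrix are holomorphic. -/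
theorem IsEigenvalueBranches.holomorphicOn {n m : ℕ} {A : X → Matrix (Fin n) (Fin n) ℂ} {ξ : X}
    {w : Fin m → ℂ} {U : Set X} {lam : Fin m → X → ℂ} (h : IsEigenvalueBranches A ξ w U lam)
    (hU : IsOpen U) (S : ComplexSpace X) (hA : ∀ ζ, S.regularityClass.MatrixAt A ζ) (j : Fin m) :
    S.HolomorphicOn (lam j) U := by
  intro x hx
  obtain ⟨k, hk⟩ : ∃ k, algMult (A ξ) (w j) = k + 1 := by
    refine Nat.exists_eq_succ_of_ne_zero ?_
    rw [← h.algMult_eq x hx j, algMult]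
    refine Nat.pos_iff_ne_zero.mp ((rootMultiplicity_pos (A x).charpoly_monic.ne_zero).mpr ?_)
    exact (mem_eigenvalues_iff_isRoot _ _).mp ((h.mem_iff x hx _).mpr ⟨j, rfl⟩)
  have hmult : ∀ ζ ∈ U, (A ζ).charpoly.rootMultiplicity (lam j ζ) = k + 1 := fun ζ hζ =>
    (h.algMult_eq ζ hζ j).trans hk
  -- A root of constant multiplicity `k + 1` along the branch is a simple root of the `k`-th
  -- derivative, whose coefficients are again holomorphic.
  refine ComplexSpace.holomorphicAt_of_simple_root (S := S) (N := n + 1)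
    (q := fun ζ => derivative^[k] (A ζ).charpoly) ?_ ?_ (h.continuousAt hU hx j) ?_ ?_
  · intro y
    have h1 := natDegree_iterate_derivative (A y).charpoly k
    rw [Matrix.charpoly_natDegree_eq_dim, Fintype.card_fin] at h1
    omega
  · intro i
    simp only [coeff_iterate_derivative]
    exact (S.regularityClass.at_ x).nsmul_mem ((hA x).charpoly_coeff (i + k)) _
  · filter_upwards [hU.mem_nhds hx] with y hy
    refine isRoot_iterate_derivative_of_lt_rootMultiplicity ?_
    rw [hmult y hy]
    exact Nat.lt_succ_self k
  · rw [← Function.iterate_succ_apply' derivative]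
    intro h0
    have h1 := (lt_rootMultiplicity_iff_isRoot_iterate_derivative (t := lam j x) (n := k + 1)
      (A x).charpoly_monic.ne_zero).mpr fun i hi => by
        rcases hi.lt_or_eq with hi' | rfl
        · exact isRoot_iterate_derivative_of_lt_rootMultiplicity (by rw [hmult x hx]; exact hi')
        · exact h0
    rw [hmult x hx] at h1
    exact lt_irrefl _ h1

end ComplexSpaces

end JordanStability

/-! ### Assembly of the cycle of implications -/

theorem mainTheorem4 {X : Type*} [TopologicalSpace X] {n : ℕ}
    (A : X → Matrix (Fin n) (Fin n) ℂ) (hA : Continuous A)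
    (ξ : X) (hξ : ¬ IsSplittingPoint A ξ)
    {m : ℕ} (w : Fin m → ℂ) (hw : Function.Injective w)
    (hw_eig : ∀ μ : ℂ, μ ∈ JordanStability.eigenvalues (A ξ) ↔ ∃ j, w j = μ) :
    -- on all sufficiently small open neighborhoods there are eigenvalue branches
    (∃ U₀ : Set X, IsOpen U₀ ∧ ξ ∈ U₀ ∧
      ∀ U : Set X, IsOpen U → ξ ∈ U → U ⊆ U₀ →
        ∃ lam : Fin m → X → ℂ, IsEigenvalueBranches A ξ w U lam) ∧
    ∀ U : Set X, IsOpen U → ξ ∈ U →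
      ∀ lam : Fin m → X → ℂ, IsEigenvalueBranches A ξ w U lam →
        -- on a connected neighborhood the branches are uniquely determined
        (IsConnected U → ∀ lam' : Fin m → X → ℂ, IsEigenvalueBranches A ξ w U lam' →
          ∀ j, EqOn (lam' j) (lam j) U) ∧
        -- the continuous case
        List.TFAE [
          BranchBlockCountsConstant A ξ U lam,
          TotalBlockCountsConstant A ξ U,
          ThetaRanksConstant A ξ U,
          BranchRanksConstant A ξ U lam,
          ContinuousJordanization A ξ U] ∧
        -- the holomorphic case
        ∀ S : ComplexSpace X, S.MatrixHolomorphicOn A univ →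
          (∀ j, S.HolomorphicOn (lam j) U) ∧
          List.TFAE [
            BranchBlockCountsConstant A ξ U lam,
            TotalBlockCountsConstant A ξ U,
            ThetaRanksConstant A ξ U,
            BranchRanksConstant A ξ U lam,
            HolomorphicJordanization S A ξ U] := by
  refine ⟨?_, fun U hU hξU lam h => ⟨?_, ?_, ?_⟩⟩
  · obtain ⟨U₀, hU₀, hξ₀, lam, h⟩ := exists_eigenvalueBranches hA hξ hw hw_eig
    exact ⟨U₀, hU₀, hξ₀, fun U _ _ hU => ⟨lam, h.mono hU⟩⟩
  · exact fun hconn lam' h' j => h.eqOn h' hU hξU hconn.isPreconnected j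
  · tfae_have 1 → 2 := totalBlockCountsConstant_of_branch h
    tfae_have 2 → 3 := thetaRanksConstant_of_totalBlockCounts
    tfae_have 3 → 4 := fun ht => (branchRanksConstant_iff h hU hξU).mpr
      (branchNullitiesConstant_of_thetaRanks h hA hU hξU ht)
    tfae_have 4 → 5 := fun hr => by
      refine (exists_jordanization (RegularityClass.continuous X) h hU hξU
        (fun ζ a b => ((continuous_id.matrix_elem a b).comp hA).continuousAt)
        (fun j ζ hζ => h.continuousAt hU hζ j) ((branchRanksConstant_iff h hU hξU).mp hr)).mono ?_
      rintro V ⟨T, hT, hTJ⟩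
      exact ⟨T, fun ζ hζ => (continuousAt_generalLinearGroup (hT ζ hζ)).continuousWithinAt, hTJ⟩
    tfae_have 5 → 1 := fun hJ => (branchBlockCountsConstant_iff hU hξU).mpr
      (branchNullitiesConstant_of_continuousJordanization h hA hU hξU hJ)
    tfae_finish
  · intro S hS
    have hSA : ∀ ζ, S.regularityClass.MatrixAt A ζ := fun ζ =>
      ComplexSpace.matrixHolomorphicOn_iff.mp hS ζ (mem_univ ζ)
    have hlam := h.holomorphicOn hU S hSA
    refine ⟨hlam, ?_⟩
    tfae_have 1 → 2 := totalBlockCountsConstant_of_branch h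
    tfae_have 2 → 3 := thetaRanksConstant_of_totalBlockCounts
    tfae_have 3 → 4 := fun ht => (branchRanksConstant_iff h hU hξU).mpr
      (branchNullitiesConstant_of_thetaRanks h hA hU hξU ht)
    tfae_have 4 → 5 := fun hr => by
      refine (exists_jordanization S.regularityClass h hU hξU hSA hlam
        ((branchRanksConstant_iff h hU hξU).mp hr)).mono ?_
      rintro V ⟨T, hT, hTJ⟩
      exact ⟨T, ComplexSpace.matrixHolomorphicOn_iff.mpr hT, hTJ⟩
    -- A holomorphic Jordanization is in particular continuous, so the continuous argument applies.
    tfae_have 5 → 1 := fun hJ => by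
      refine (branchBlockCountsConstant_iff hU hξU).mpr
        (branchNullitiesConstant_of_continuousJordanization h hA hU hξU (hJ.mono ?_))
      rintro V ⟨T, hT, hTJ⟩
      exact ⟨T, fun ζ hζ => (continuousAt_generalLinearGroup
        (ComplexSpace.matrixHolomorphicOn_iff.mp hT ζ hζ)).continuousWithinAt, hTJ⟩
    tfae_finish
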